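/- **Conventions.** Let $R$ be a unital associative ring; modules are left modules, and right $R$-modules are identified with modules over the opposite ring $R^{\circ}$. For a left (resp. right) $R$-module $M$ let $M^{+}=\mathrm{Hom}_{\mathbb Z}(M,\mathbb Q/\mathbb Z)$ be its character dual, a right (resp. left) $R$-module. A pair $(\mathsf A,\mathsf B)$ of classes $\mathsf A\subseteq \mathrm{Mod}(R)$, $\mathsf B\subseteq \mathrm{Mod}(R^{\circ})$ is a *duality pair* if (i) $M\in\mathsf A\iff M^{+}\in\mathsf B$ for every $M\in\mathrm{Mod}(R)$, and (ii) $\mathsf B$ is closed under finite direct sums (including the empty one) and direct summands; duality pairs $(\mathsf B,\mathsf A)$ are defined in the same way with the roles of $R$ and $R^\circ$ exchanged. The pair is *product-closed* if $\mathsf A$ is closed under arbitrary products, and *symmetric* if $(\mathsf A,\mathsf B)$ and $(\mathsf B,\mathsf A)$ are both duality pairs. Let $(\mathrm{mod}(R),\mathbf{Ab})^{\mathrm{fp}}$ be the category of finitely presented functors, i.e. of those functors $Q$ from finitely presented $R$-modules to abelian groups for which there are a map $f\colon A\to B$ of finitely presented modules and an exact sequence $\mathrm{Hom}_R(B,-)\xrightarrow{f^*}\mathrm{Hom}_R(A,-)\to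 Q\to 0$; write $\tilde Q=\mathrm{coker}\big(\mathrm{Hom}_R(B,-)\to \mathrm{Hom}_R(A,-)\big)$ for the extension of $Q$ to $\mathrm{Mod}(R)$. For a collection $\mathcal S$ of finitely presented functors put $\mathrm{Ker}(\mathcal S)=\{M\in\mathrm{Mod}(R):\tilde Q(M)=0\text{ for all }Q\in\mathcal S\}$. A class $\mathcal D\subseteq\mathrm{Mod}(R)$ is *definable* if $\mathcal D=\mathrm{Ker}(\mathcal S)$ for some such $\mathcal S$. Its *dual definable class* is $\mathcal D^{d}=\mathrm{Ker}(\delta(\mathcal S_{\mathcal D}))\subseteq\mathrm{Mod}(R^{\circ})$, where $\mathcal S_{\mathcal D}$ is the class of all finitely presented functors $Q$ with $\tilde Q(M)=0$ for all $M\in\mathcal D$, and $\delta\colon(\mathrm{mod}(R),\mathbf{Ab})^{\mathrm{fp}}\to(\mathrm{mod}(R^\circ),\mathbf{Ab})^{\mathrm{fp}}$ is the Auslander–Gruson–Jensen functor $(\delta Q)(N)=\mathrm{Hom}(Q,N\otimes_R-)$. For definable $\mathcal D\subseteq\mathrm{Mod}(R^\circ)$ the class $\mathcal D^d\subseteq\mathrm{Mod}(R)$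 is defined in the same way, with $(\delta F)(N)=\mathrm{Hom}(F,-\otimes_R N)$. **Theorem.** Let $R$ be a ring and let $\mathcal D$ be a definable class in $\mathrm{Mod}(R)$. Then $(\mathcal D,\mathcal D^{d})$ is a symmetric, product-closed duality pair. Moreover, if $(\mathsf A,\mathsf B)$ is a symmetric duality pair with $\mathsf A\subseteq\mathrm{Mod}(R)$ and $\mathsf B\subseteq\mathrm{Mod}(R^\circ)$, then the following are equivalent: 1. at least one of $\mathsf A$, $\mathsf B$ is closed under coproducts; 2. at least one of $\mathsf A$, $\mathsf B$ is closed under products; 3. $\mathsf A$ is definable and $\mathsf B=\mathsf A^{d}$; 4. $\mathsf B$ is definable and $\mathsf A=\mathsf B^{d}$. In particular, if at least one of the two classes is closed under products or under coproducts, then both classes are closed under products and under coproducts, and both are definable. -/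

import Mathlib

open CategoryTheory CategoryTheory.Limits Opposite
open scoped TensorProduct

universe u

/-! Left `R`-modules are the objects of `ModuleCat R`; right `R`-modules are the objects of
`ModuleCat Rᵐᵒᵖ`, with `m r = MulOpposite.op r • m`. A class of modules is an `ObjectProperty`. -/

/-! ### Character duals -/

section CharacterDual

variable (R : Type u) [Ring R]

/-- The right `R`-module structure on `Hom_ℤ(M, ℚ/ℤ)`, for a left module `M`: `(c r)(m) = c (r m)`. -/
@[reducible] def charModuleRight (M : Type u) [AddCommGroup M] [Module R M] :
    Module Rᵐᵒᵖ (CharacterModule M) where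
  smul r c := AddMonoidHom.comp (c : M →+ AddCircle (1 : ℚ)) (DistribSMul.toAddMonoidHom M r.unop)
  one_smul c := CharacterModule.ext M fun m => congrArg c (one_smul R m)
  mul_smul r s c := CharacterModule.ext M fun m => congrArg c (mul_smul s.unop r.unop m)
  smul_zero _ := rfl
  smul_add _ _ _ := rfl
  add_smul r s c := CharacterModule.ext M fun m =>
    (congrArg c (add_smul r.unop s.unop m)).trans (map_add c _ _)
  zero_smul c := CharacterModule.ext M fun m => (congrArg c (zero_smul R m)).trans (map_zero c)

/-- The left `R`-module structure on `Hom_ℤ(N, ℚ/ℤ)`, for a right module `N`: `(r c)(n) = c (n r)`. -/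
@[reducible] def charModuleLeft (N : Type u) [AddCommGroup N] [Module Rᵐᵒᵖ N] :
    Module R (CharacterModule N) where
  smul r c := AddMonoidHom.comp (c : N →+ AddCircle (1 : ℚ))
    (DistribSMul.toAddMonoidHom N (MulOpposite.op r))
  one_smul c := CharacterModule.ext N fun n => congrArg c (one_smul Rᵐᵒᵖ n)
  mul_smul r s c := CharacterModule.ext N fun n =>
    congrArg c (mul_smul (MulOpposite.op s) (MulOpposite.op r) n)
  smul_zero _ := rfl
  smul_add _ _ _ := rfl
  add_smul r s c := CharacterModule.ext N fun n =>
    (congrArg c (add_smul (MulOpposite.op r) (MulOpposite.op s) n)).trans (map_add c _ _)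
  zero_smul c := CharacterModule.ext N fun n => (congrArg c (zero_smul Rᵐᵒᵖ n)).trans (map_zero c)

/-- The character dual `M⁺ = Hom_ℤ(M, ℚ/ℤ)` of a left module, a right module. -/
def charDual (M : ModuleCat.{u} R) : ModuleCat.{u} Rᵐᵒᵖ :=
  letI := charModuleRight R M
  ModuleCat.of Rᵐᵒᵖ (CharacterModule M)

/-- The character dual `N⁺ = Hom_ℤ(N, ℚ/ℤ)` of a right module, a left module. -/
def charDualOp (N : ModuleCat.{u} Rᵐᵒᵖ) : ModuleCat.{u} R :=
  letI := charModuleLeft R N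
  ModuleCat.of R (CharacterModule N)

end CharacterDual

/-! ### Closure properties and duality pairs -/

section DualityPairs

/-- Closure under arbitrary (small) products. -/
def IsProductClosed {R : Type u} [Ring R] (A : ObjectProperty (ModuleCat.{u} R)) : Prop :=
  ∀ ι : Type u, A.IsClosedUnderLimitsOfShape (Discrete ι)

/-- Closure under arbitrary (small) coproducts. -/
def IsCoproductClosed {R : Type u} [Ring R] (A : ObjectProperty (ModuleCat.{u} R)) : Prop :=
  ∀ ι : Type u, A.IsClosedUnderColimitsOfShape (Discrete ι)

/-- `(A, B)` is a duality pair with respect to the duality `dual` on objects: `M ∈ A` iff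
`dual M ∈ B`, and `B` is closed under finite direct sums and direct summands. -/
structure IsDualityPair {R S : Type u} [Ring R] [Ring S]
    (dual : ModuleCat.{u} R → ModuleCat.{u} S)
    (A : ObjectProperty (ModuleCat.{u} R)) (B : ObjectProperty (ModuleCat.{u} S)) : Prop where
  mem_iff : ∀ M, A M ↔ B (dual M)
  finite_sums : B.IsClosedUnderFiniteCoproducts
  summands : B.IsStableUnderRetracts

/-- Both `(A, B)` and `(B, A)` are duality pairs under the character dual. -/
def IsSymmetricDualityPair (R : Type u) [Ring R] (A : ObjectProperty (ModuleCat.{u} R))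
    (B : ObjectProperty (ModuleCat.{u} Rᵐᵒᵖ)) : Prop :=
  IsDualityPair (charDual R) A B ∧ IsDualityPair (charDualOp R) B A

end DualityPairs

/-! ### Finitely presented functors and definable classes

Functors take values in `AddCommGrpCat.{u + 1}`, so that groups of natural transformations between
functors on the (large, but essentially small) category of finitely presented modules are again
allowed as values. Values of Hom and of the tensor product are lifted to that universe. -/

noncomputable section

/-- The category of finitely presented `R`-modules. -/
abbrev FPMod (R : Type u) [Ring R] :=
  ObjectProperty.FullSubcategory (fun M : ModuleCat.{u} R => Module.FinitePresentation R M)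

/-- The inclusion of finitely presented modules into all modules. -/
abbrev FPMod.incl (R : Type u) [Ring R] : FPMod R ⥤ ModuleCat.{u} R :=
  ObjectProperty.ι (fun M : ModuleCat.{u} R => Module.FinitePresentation R M)

/-- The covariant Hom functors `A ↦ Hom(A, -)`. -/
abbrev homFunctor (C : Type (u + 1)) [Category.{u} C] [Preadditive C] :
    Cᵒᵖ ⥤ C ⥤ AddCommGrpCat.{u + 1} :=
  preadditiveCoyoneda ⋙ (Functor.whiskeringRight _ _ _).obj AddCommGrpCat.uliftFunctor.{u + 1, u}

/-- A presentation `Hom(B, -) ⟶ Hom(A, -) ⟶ Q ⟶ 0` of a functor `Q` on finitely presented modules,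
induced by `f : A ⟶ B`. -/
structure FunctorPresentation {R : Type u} [Ring R] (Q : FPMod R ⥤ AddCommGrpCat.{u + 1}) where
  {A B : FPMod R}
  f : A ⟶ B
  π : (homFunctor (FPMod R)).obj (op A) ⟶ Q
  comp_zero : (homFunctor (FPMod R)).map f.op ≫ π = 0
  exact : (ShortComplex.mk _ π comp_zero).Exact
  epi : Epi π

/-- `Q` is a finitely presented functor. -/
def IsFPFunctor {R : Type u} [Ring R] (Q : FPMod R ⥤ AddCommGrpCat.{u + 1}) : Prop :=
  Nonempty (FunctorPresentation Q)

/-- Finitely presented functors are additive. As natural transformations of additive functors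
are just natural transformations, additivity need not be part of the definition. -/
theorem IsFPFunctor.additive {R : Type u} [Ring R] {Q : FPMod R ⥤ AddCommGrpCat.{u + 1}}
    (hQ : IsFPFunctor Q) : Q.Additive := by
  obtain ⟨P⟩ := hQ
  have := P.epi
  refine ⟨fun {X Y g h} => ?_⟩
  rw [← cancel_epi (P.π.app X), Preadditive.comp_add]
  simp only [← P.π.naturality]
  rw [← Preadditive.add_comp]
  congr 1

/-- The functor on all modules `coker(Hom(B, -) ⟶ Hom(A, -))` that extends `Q`. Up to isomorphism it
does not depend on the presentation. -/
def FunctorPresentation.extension {R : Type u} [Ring R] {Q : FPMod R ⥤ AddCommGrpCat.{u + 1}}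
    (P : FunctorPresentation Q) : ModuleCat.{u} R ⥤ AddCommGrpCat.{u + 1} :=
  cokernel ((homFunctor (ModuleCat.{u} R)).map ((FPMod.incl R).map P.f).op)

/-- `Q` is finitely presented and the extension of `Q` to all modules vanishes at `M`. -/
def ExtensionVanishes {R : Type u} [Ring R] (Q : FPMod R ⥤ AddCommGrpCat.{u + 1})
    (M : ModuleCat.{u} R) : Prop :=
  ∃ P : FunctorPresentation Q, IsZero (P.extension.obj M)

/-- `Ker 𝒮`: the modules at which the extensions of all functors in `𝒮` vanish. -/
def functorKer {R : Type u} [Ring R] (𝒮 : ObjectProperty (FPMod R ⥤ AddCommGrpCat.{u + 1})) :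
    ObjectProperty (ModuleCat.{u} R) :=
  fun M => ∀ Q, 𝒮 Q → ExtensionVanishes Q M

/-- A class of modules is definable if it is the kernel of a collection of finitely presented
functors (the category of finitely presented functors being essentially small, it makes no
difference whether the collection is a set). -/
def IsDefinable {R : Type u} [Ring R] (D : ObjectProperty (ModuleCat.{u} R)) : Prop :=
  ∃ 𝒮 : ObjectProperty (FPMod R ⥤ AddCommGrpCat.{u + 1}),
    (∀ Q, 𝒮 Q → IsFPFunctor Q) ∧ D = functorKer 𝒮

/-- The finitely presented functors that vanish on `D`. -/
def annihilator {R : Type u} [Ring R] (D : ObjectProperty (ModuleCat.{u} R)) :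
    ObjectProperty (FPMod R ⥤ AddCommGrpCat.{u + 1}) :=
  fun Q => IsFPFunctor Q ∧ ∀ M, D M → ExtensionVanishes Q M

/-! ### Tensor products over a noncommutative ring -/

section Tensor

variable (R : Type u) [Ring R]

/-- The relations `(m r) ⊗ n = m ⊗ (r n)`. -/
def balancedRelations (M N : Type u) [AddCommGroup M] [Module Rᵐᵒᵖ M] [AddCommGroup N]
    [Module R N] : AddSubgroup (M ⊗[ℤ] N) :=
  AddSubgroup.closure
    {x | ∃ (m : M) (r : R) (n : N), x = (MulOpposite.op r • m) ⊗ₜ[ℤ] n - m ⊗ₜ[ℤ] (r • n)}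

/-- The tensor product `M ⊗_R N` of a right module `M` and a left module `N`. -/
abbrev BalancedTensor (M N : Type u) [AddCommGroup M] [Module Rᵐᵒᵖ M] [AddCommGroup N]
    [Module R N] : Type u :=
  (M ⊗[ℤ] N) ⧸ balancedRelations R M N

variable {M M' N N' : Type u} [AddCommGroup M] [Module Rᵐᵒᵖ M] [AddCommGroup M'] [Module Rᵐᵒᵖ M']
  [AddCommGroup N] [Module R N] [AddCommGroup N'] [Module R N']

theorem balancedRelations_le (f : M →ₗ[Rᵐᵒᵖ] M') (g : N →ₗ[R] N') :
    balancedRelations R M N ≤ (balancedRelations R M' N').comap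
      (TensorProduct.map f.toAddMonoidHom.toIntLinearMap
        g.toAddMonoidHom.toIntLinearMap).toAddMonoidHom := by
  refine (AddSubgroup.closure_le _).2 ?_
  rintro _ ⟨m, r, n, rfl⟩
  refine AddSubgroup.subset_closure ⟨f m, r, g n, ?_⟩
  simp

/-- The map `f ⊗ g`. -/
def balancedMap (f : M →ₗ[Rᵐᵒᵖ] M') (g : N →ₗ[R] N') :
    BalancedTensor R M N →+ BalancedTensor R M' N' :=
  QuotientAddGroup.map _ _ _ (balancedRelations_le R f g)

theorem balanced_hom_ext {G : Type*} [AddCommGroup G] {φ ψ : BalancedTensor R M N →+ G}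
    (h : ∀ m n, φ (QuotientAddGroup.mk (m ⊗ₜ[ℤ] n)) = ψ (QuotientAddGroup.mk (m ⊗ₜ[ℤ] n))) :
    φ = ψ := by
  refine QuotientAddGroup.addMonoidHom_ext _ (AddMonoidHom.ext fun x => ?_)
  induction x using TensorProduct.induction_on with
  | zero => simp
  | tmul m n => exact h m n
  | add x y hx hy => rw [map_add, map_add, hx, hy]

/-- The bifunctor `(M, N) ↦ M ⊗_R N`. -/
def tensorBifunctor : ModuleCat.{u} Rᵐᵒᵖ ⥤ ModuleCat.{u} R ⥤ AddCommGrpCat.{u} where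
  obj M :=
    { obj := fun N => AddCommGrpCat.of (BalancedTensor R M N)
      map := fun g => AddCommGrpCat.ofHom (balancedMap R LinearMap.id g.hom)
      map_id := fun _ => AddCommGrpCat.hom_ext (balanced_hom_ext R fun _ _ => rfl)
      map_comp := fun _ _ => AddCommGrpCat.hom_ext (balanced_hom_ext R fun _ _ => rfl) }
  map f :=
    { app := fun _ => AddCommGrpCat.ofHom (balancedMap R f.hom LinearMap.id)
      naturality := fun _ _ _ => AddCommGrpCat.hom_ext (balanced_hom_ext R fun _ _ => rfl) }
  map_id _ := NatTrans.ext (funext fun _ =>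
    AddCommGrpCat.hom_ext (balanced_hom_ext R fun _ _ => rfl))
  map_comp _ _ := NatTrans.ext (funext fun _ =>
    AddCommGrpCat.hom_ext (balanced_hom_ext R fun _ _ => rfl))

/-- The tensor product restricted to finitely presented modules: `M ↦ (M ⊗_R -)`. -/
def tensorFP : FPMod Rᵐᵒᵖ ⥤ FPMod R ⥤ AddCommGrpCat.{u + 1} :=
  FPMod.incl Rᵐᵒᵖ ⋙ tensorBifunctor R ⋙ (Functor.whiskeringLeft _ _ _).obj (FPMod.incl R) ⋙
    (Functor.whiskeringRight _ _ _).obj AddCommGrpCat.uliftFunctor.{u + 1, u}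

end Tensor

/-! ### Auslander-Gruson-Jensen duality and dual definable classes -/

section AGJ

variable (R : Type u) [Ring R]

/-- The functor `δ` from left to right modules, `(δ Q)(M) = Hom(Q, M ⊗_R -)`. -/
def agj : (FPMod R ⥤ AddCommGrpCat.{u + 1})ᵒᵖ ⥤ (FPMod Rᵐᵒᵖ ⥤ AddCommGrpCat.{u + 1}) :=
  preadditiveCoyoneda ⋙ (Functor.whiskeringLeft _ _ _).obj (tensorFP R)

/-- The functor `δ` from right to left modules, `(δ F)(N) = Hom(F, - ⊗_R N)`. -/
def agjOp : (FPMod Rᵐᵒᵖ ⥤ AddCommGrpCat.{u + 1})ᵒᵖ ⥤ (FPMod R ⥤ AddCommGrpCat.{u + 1}) :=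
  preadditiveCoyoneda ⋙ (Functor.whiskeringLeft _ _ _).obj (tensorFP R).flip

/-- The dual definable class `Dᵈ = Ker (δ (𝒮_D))` of a definable class `D` of left modules. -/
def dualDefinable (D : ObjectProperty (ModuleCat.{u} R)) : ObjectProperty (ModuleCat.{u} Rᵐᵒᵖ) :=
  functorKer fun G => ∃ Q, annihilator D Q ∧ G = (agj R).obj (op Q)

/-- The dual definable class `Dᵈ = Ker (δ (𝒮_D))` of a definable class `D` of right modules. -/
def dualDefinableOp (D : ObjectProperty (ModuleCat.{u} Rᵐᵒᵖ)) : ObjectProperty (ModuleCat.{u} R) :=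
  functorKer fun G => ∃ F, annihilator D F ∧ G = (agjOp R).obj (op F)

end AGJ

end

/-! A map `f : A → B` between finitely presented modules presents a functor
`Q = coker (Hom(B, -) → Hom(A, -))`, and the extension of `Q` vanishes at `M` iff `M` is injective
with respect to `f`, that is, iff every map `A → M` extends along `f` (`Extends f M`); this does not
depend on the presentation (`FunctorPresentation.extensionVanishes_iff`). So definable classes are
given by injectivity conditions of this kind.

By the Yoneda lemma `(δ Q)(N)` is the kernel of `N ⊗ f`. This kernel has a presentation by finitely
presented modules that is valid for all modules `N` (`exists_presentation_ker`); hence the extension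
of `δ Q` vanishes at `N` iff `N ⊗ f` is injective, iff `N⁺` is injective with respect to `f`
(`map_injective_iff_extends_dual`). Therefore `Dᵈ = {N | N⁺ ∈ D}` for definable `D`. Since
`M⁺ ⊗ A` is the group of characters of `Hom(A, M)` for finitely presented `A`, the modules `M` and
`M⁺⁺` are injective with respect to the same maps (`extends_iff_extends_bidual`). Together these facts
make `(D, Dᵈ)` a symmetric duality pair.

Let now `(A, B)` be a symmetric duality pair. The transpose of a pure embedding is a split surjection
(`IsPureMap.exists_section`), so both classes are closed under pure submodules. A direct sum is
pure in the product, and `∏ Nᵢ` is pure in `(⨁ Nᵢ⁺)⁺`; so closure under products implies closure under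
coproducts for each class, and closure of one class under coproducts implies closure of the other
under products. All four closure properties are therefore equivalent.

It remains to see that `A` is definable if they hold (`IsSymmPair.isDefinable`). Suppose that `M` is
injective with respect to each `f` with respect to which all modules in `A` are. For finitely
presented `X` there is a map `g : X → D` with `D ∈ A` that factors only through such `f : X → Y`
(`exists_almost_preenvelope`). Elements of a tensor product vanish for finitary reasons
(`Tens.exists_factorization`), and `M⁺ ⊗ f` is injective for these `f`, so `M⁺ ⊗ g` is injective. By
duality every map `X → M⁺⁺` extends along `g`. Hence `M⁺⁺` is a pure quotient of a coproduct of
modules in `A`. The transpose of a pure epimorphism is a split injection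
(`exists_retraction_dual_map`), so `M⁺⁺⁺ ∈ B`, and `M⁺⁺ ∈ A` and `M ∈ A` follow by duality.

All arguments about modules are given for two rings with an anti-isomorphism between them, so that
each of them applies to left and to right modules. -/

/-! ### Anti-isomorphisms of rings and character duals -/

/-- An anti-isomorphism from the ring `R` to the ring `S`. It identifies left `R`-modules with right
`S`-modules; the two instances of interest are `R → Rᵐᵒᵖ` and its inverse, so that every statement
below serves both sides of a duality. -/
structure AntiEquiv (R S : Type u) [Ring R] [Ring S] where
  toFun : R → S
  inv : S → R
  left_inv : ∀ r, inv (toFun r) = r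
  right_inv : ∀ s, toFun (inv s) = s
  map_one : toFun 1 = 1
  map_mul : ∀ a b, toFun (a * b) = toFun b * toFun a
  map_add : ∀ a b, toFun (a + b) = toFun a + toFun b

namespace AntiEquiv

variable {R S : Type u} [Ring R] [Ring S] (σ : AntiEquiv R S)

theorem inv_one : σ.inv 1 = 1 := by rw [← σ.map_one, σ.left_inv]

theorem inv_mul (a b : S) : σ.inv (a * b) = σ.inv b * σ.inv a := by
  rw [← σ.left_inv (σ.inv b * σ.inv a), σ.map_mul, σ.right_inv, σ.right_inv]

theorem inv_add (a b : S) : σ.inv (a + b) = σ.inv a + σ.inv b := by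
  rw [← σ.left_inv (σ.inv a + σ.inv b), σ.map_add, σ.right_inv, σ.right_inv]

theorem map_zero : σ.toFun 0 = 0 := by
  have h := σ.map_add 0 0
  rwa [add_zero, left_eq_add] at h

theorem inv_zero : σ.inv 0 = 0 := by rw [← σ.map_zero, σ.left_inv]

theorem map_sum {ι : Type*} (s : Finset ι) (g : ι → R) :
    σ.toFun (∑ i ∈ s, g i) = ∑ i ∈ s, σ.toFun (g i) :=
  _root_.map_sum (⟨⟨σ.toFun, σ.map_zero⟩, σ.map_add⟩ : R →+ S) g s

/-- The inverse anti-isomorphism. -/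
def symm : AntiEquiv S R where
  toFun := σ.inv
  inv := σ.toFun
  left_inv := σ.right_inv
  right_inv := σ.left_inv
  map_one := σ.inv_one
  map_mul := σ.inv_mul
  map_add := σ.inv_add

/-- The tautological anti-isomorphism from a ring to its opposite. -/
def op (R : Type u) [Ring R] : AntiEquiv R Rᵐᵒᵖ where
  toFun := MulOpposite.op
  inv := MulOpposite.unop
  left_inv _ := rfl
  right_inv _ := rfl
  map_one := rfl
  map_mul _ _ := rfl
  map_add _ _ := rfl

end AntiEquiv

section Dual

variable {R S : Type u} [Ring R] [Ring S] (σ : AntiEquiv R S)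

/-- The character dual of the left `R`-module `M`, as a left `S`-module by means of the
anti-isomorphism `σ`. -/
def Dual (_ : AntiEquiv R S) (M : Type u) [AddCommGroup M] : Type u := CharacterModule M

variable {M : Type u} [AddCommGroup M]

instance : AddCommGroup (Dual σ M) := inferInstanceAs (AddCommGroup (CharacterModule M))

instance : FunLike (Dual σ M) M (AddCircle (1 : ℚ)) :=
  inferInstanceAs (FunLike (CharacterModule M) M (AddCircle (1 : ℚ)))

instance : AddMonoidHomClass (Dual σ M) M (AddCircle (1 : ℚ)) where
  map_add c := AddMonoidHom.map_add c
  map_zero c := AddMonoidHom.map_zero c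

theorem Dual.ext {c d : Dual σ M} (h : ∀ m, c m = d m) : c = d := DFunLike.ext _ _ h

/-- A homomorphism to `ℚ/ℤ`, as an element of the character dual. -/
def Dual.mk (c : M →+ AddCircle (1 : ℚ)) : Dual σ M := c

@[simp] theorem Dual.mk_apply (c : M →+ AddCircle (1 : ℚ)) (m : M) : Dual.mk σ c m = c m := rfl
@[simp] theorem Dual.zero_apply (m : M) : (0 : Dual σ M) m = 0 := rfl

variable [Module R M]

instance : Module S (Dual σ M) where
  smul s c := AddMonoidHom.comp (c : M →+ AddCircle (1 : ℚ))
    (DistribSMul.toAddMonoidHom M (σ.inv s))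
  one_smul c := Dual.ext σ fun m => congrArg c (by
    change σ.inv 1 • m = m
    rw [σ.inv_one, one_smul])
  mul_smul r s c := Dual.ext σ fun m => congrArg c (by
    change σ.inv (r * s) • m = σ.inv s • σ.inv r • m
    rw [σ.inv_mul, mul_smul])
  smul_zero _ := rfl
  smul_add _ _ _ := rfl
  add_smul r s c := Dual.ext σ fun m => by
    change c (σ.inv (r + s) • m) = c (σ.inv r • m) + c (σ.inv s • m)
    rw [σ.inv_add, add_smul, _root_.map_add]
  zero_smul c := Dual.ext σ fun m => by
    change c (σ.inv 0 • m) = 0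
    rw [σ.inv_zero, zero_smul, _root_.map_zero]

@[simp] theorem Dual.smul_apply (s : S) (c : Dual σ M) (m : M) : (s • c) m = c (σ.inv s • m) := rfl

/-- The transpose of a linear map. -/
def Dual.map {M' : Type u} [AddCommGroup M'] [Module R M'] (f : M →ₗ[R] M') :
    Dual σ M' →ₗ[S] Dual σ M where
  toFun c := Dual.mk σ ((c : M' →+ AddCircle (1 : ℚ)).comp f.toAddMonoidHom)
  map_add' _ _ := rfl
  map_smul' s c := Dual.ext σ fun m => congrArg c (f.map_smul (σ.inv s) m).symm

/-- The canonical map from a module to its double dual. -/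
def Dual.eval (M : Type u) [AddCommGroup M] [Module R M] : M →ₗ[R] Dual σ.symm (Dual σ M) where
  toFun m := Dual.mk σ.symm
    { toFun := fun c => c m, map_zero' := rfl, map_add' := fun _ _ => rfl }
  map_add' m m' := Dual.ext _ fun c => map_add c m m'
  map_smul' r m := Dual.ext _ fun c => by
    change c (r • m) = c (σ.inv (σ.toFun r) • m)
    rw [σ.left_inv]

end Dual

section Characters

/-- Injectivity of `ℚ/ℤ`: a character of `X` that kills the kernel of `f : X → Y` comes from a
character of `Y`. -/
theorem exists_character_comp_eq {X Y : Type*} [AddCommGroup X] [AddCommGroup Y] (f : X →+ Y)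
    (c : X →+ AddCircle (1 : ℚ)) (h : ∀ x, f x = 0 → c x = 0) :
    ∃ d : Y →+ AddCircle (1 : ℚ), ∀ x, d (f x) = c x := by
  obtain ⟨d, hd⟩ := (Module.Baer.of_divisible (AddCircle (1 : ℚ))).extension_property_addMonoidHom
    (QuotientAddGroup.kerLift f) (QuotientAddGroup.kerLift_injective f)
    (QuotientAddGroup.lift f.ker c h)
  exact ⟨d, fun x => DFunLike.congr_fun hd (QuotientAddGroup.mk x)⟩

/-- Characters separate the points outside the image of a homomorphism from it. -/
theorem exists_character_of_notMem_range {X Y : Type*} [AddCommGroup X] [AddCommGroup Y]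
    (f : X →+ Y) (y : Y) (hy : y ∉ f.range) :
    ∃ d : Y →+ AddCircle (1 : ℚ), (∀ x, d (f x) = 0) ∧ d y ≠ 0 := by
  obtain ⟨c, hc⟩ := CharacterModule.exists_character_apply_ne_zero_of_ne_zero
    (a := (QuotientAddGroup.mk y : Y ⧸ f.range)) (by rwa [Ne, QuotientAddGroup.eq_zero_iff])
  refine ⟨AddMonoidHom.comp c (QuotientAddGroup.mk' f.range), fun x => ?_, hc⟩
  have : (QuotientAddGroup.mk (f x) : Y ⧸ f.range) = 0 :=
    (QuotientAddGroup.eq_zero_iff _).2 ⟨x, rfl⟩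
  exact (congrArg c this).trans (map_zero c)

end Characters

/-! ### Balanced tensor products -/

section Tens

variable {R S : Type u} [Ring R] [Ring S] (σ : AntiEquiv R S)

/-- The relations `(σ r) n ⊗ m = n ⊗ (r m)`. -/
def tensRelations (N M : Type u) [AddCommGroup N] [Module S N] [AddCommGroup M] [Module R M] :
    AddSubgroup (N ⊗[ℤ] M) :=
  AddSubgroup.closure
    {x | ∃ (n : N) (r : R) (m : M), x = (σ.toFun r • n) ⊗ₜ[ℤ] m - n ⊗ₜ[ℤ] (r • m)}

/-- The tensor product `N ⊗_R M` of a left `R`-module `M` and a left `S`-module `N`, which is viewed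
as a right `R`-module along the anti-isomorphism `σ`. -/
def Tens (N M : Type u) [AddCommGroup N] [Module S N] [AddCommGroup M] [Module R M] : Type u :=
  (N ⊗[ℤ] M) ⧸ tensRelations σ N M

variable {N N' N'' M M' M'' : Type u} [AddCommGroup N] [Module S N] [AddCommGroup N'] [Module S N']
  [AddCommGroup N''] [Module S N''] [AddCommGroup M] [Module R M] [AddCommGroup M'] [Module R M']
  [AddCommGroup M''] [Module R M'']

namespace Tens

instance : AddCommGroup (Tens σ N M) :=
  inferInstanceAs (AddCommGroup ((N ⊗[ℤ] M) ⧸ tensRelations σ N M))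

/-- The pure tensor `n ⊗ m`. -/
def tmul (n : N) (m : M) : Tens σ N M := QuotientAddGroup.mk (n ⊗ₜ[ℤ] m)

theorem add_tmul (n n' : N) (m : M) : tmul σ (n + n') m = tmul σ n m + tmul σ n' m :=
  congrArg (QuotientAddGroup.mk' (tensRelations σ N M)) (TensorProduct.add_tmul n n' m)

theorem tmul_add (n : N) (m m' : M) : tmul σ n (m + m') = tmul σ n m + tmul σ n m' :=
  congrArg (QuotientAddGroup.mk' (tensRelations σ N M)) (TensorProduct.tmul_add n m m')

theorem smul_tmul (r : R) (n : N) (m : M) : tmul σ (σ.toFun r • n) m = tmul σ n (r • m) := by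
  refine (QuotientAddGroup.eq_iff_sub_mem).2 (AddSubgroup.subset_closure ⟨n, r, m, rfl⟩)

/-- The pure tensors as a biadditive map. -/
def tmulHom : N →+ M →+ Tens σ N M :=
  AddMonoidHom.mk' (fun n => AddMonoidHom.mk' (tmul σ n) (tmul_add σ n))
    fun n n' => AddMonoidHom.ext (add_tmul σ n n')

theorem tmul_zero (n : N) : tmul σ n (0 : M) = 0 := map_zero (tmulHom σ n)

theorem zero_tmul (m : M) : tmul σ (0 : N) m = 0 := DFunLike.congr_fun (map_zero (tmulHom σ)) m

theorem tmul_sum (n : N) {ι : Type*} (s : Finset ι) (g : ι → M) :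
    tmul σ n (∑ i ∈ s, g i) = ∑ i ∈ s, tmul σ n (g i) := map_sum (tmulHom σ n) g s

theorem sum_tmul (m : M) {ι : Type*} (s : Finset ι) (g : ι → N) :
    tmul σ (∑ i ∈ s, g i) m = ∑ i ∈ s, tmul σ (g i) m :=
  map_sum ((tmulHom σ).flip m) g s

theorem tmul_sub (n : N) (m m' : M) : tmul σ n (m - m') = tmul σ n m - tmul σ n m' :=
  map_sub (tmulHom σ n) m m'

variable {σ} in
theorem induction_on {p : Tens σ N M → Prop} (t : Tens σ N M) (zero : p 0)
    (tmul : ∀ n m, p (tmul σ n m)) (add : ∀ s t, p s → p t → p (s + t)) : p t := by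
  induction t using QuotientAddGroup.induction_on with
  | H x =>
    induction x using TensorProduct.induction_on with
    | zero => exact zero
    | tmul n m => exact tmul n m
    | add x y hx hy => exact add _ _ hx hy

variable {σ} in
theorem hom_ext {G : Type*} [AddCommGroup G] {φ ψ : Tens σ N M →+ G}
    (h : ∀ n m, φ (tmul σ n m) = ψ (tmul σ n m)) : φ = ψ :=
  AddMonoidHom.ext fun t => induction_on (p := fun t => φ t = ψ t) t
    ((map_zero φ).trans (map_zero ψ).symm) h fun s t hs ht => by rw [map_add, map_add, hs, ht]

/-- The homomorphism out of the tensor product given by a balanced biadditive map. -/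
def lift {G : Type*} [AddCommGroup G] (g : N →+ M →+ G)
    (hg : ∀ n r m, g (σ.toFun r • n) m = g n (r • m)) : Tens σ N M →+ G :=
  QuotientAddGroup.lift (tensRelations σ N M)
    (TensorProduct.liftAddHom g fun k n m => by simp)
    ((AddSubgroup.closure_le _).2 (by
      rintro _ ⟨n, r, m, rfl⟩
      simp [hg]))

/-- The map `v ⊗ g`. -/
def map (v : N →ₗ[S] N') (g : M →ₗ[R] M') : Tens σ N M →+ Tens σ N' M' :=
  lift σ (((tmulHom σ).comp v.toAddMonoidHom).compr₂ (AddMonoidHom.id _) |>.compl₂ g.toAddMonoidHom)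
    fun n r m => by
      change tmul σ (v (σ.toFun r • n)) (g m) = tmul σ (v n) (g (r • m))
      rw [map_smul, map_smul, smul_tmul]

@[simp] theorem map_tmul (v : N →ₗ[S] N') (g : M →ₗ[R] M') (n : N) (m : M) :
    map σ v g (tmul σ n m) = tmul σ (v n) (g m) := rfl

theorem map_map (v : N →ₗ[S] N') (g : M →ₗ[R] M') (v' : N' →ₗ[S] N'') (g' : M' →ₗ[R] M'')
    (t : Tens σ N M) : map σ v' g' (map σ v g t) = map σ (v' ∘ₗ v) (g' ∘ₗ g) t :=
  DFunLike.congr_fun (hom_ext (φ := (map σ v' g').comp (map σ v g))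
    (ψ := map σ (v' ∘ₗ v) (g' ∘ₗ g)) fun _ _ => rfl) t

/-- Characters of `N ⊗_R M` are `R`-linear maps from `M` to the dual of `N`. -/
def toHomRight (c : Tens σ N M →+ AddCircle (1 : ℚ)) : M →ₗ[R] Dual σ.symm N where
  toFun m := Dual.mk σ.symm (c.comp ((tmulHom σ).flip m))
  map_add' m m' := Dual.ext _ fun n => (congrArg c (tmul_add σ n m m')).trans (c.map_add _ _)
  map_smul' r m := Dual.ext _ fun n => congrArg c (smul_tmul σ r n m).symm

/-- The character of `N ⊗_R M` that belongs to an `R`-linear map from `M` to the dual of `N`. -/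
def ofHomRight (h : M →ₗ[R] Dual σ.symm N) : Tens σ N M →+ AddCircle (1 : ℚ) :=
  lift σ (AddMonoidHom.flip (AddMonoidHom.mk' (fun m => ((h m : Dual σ.symm N) : N →+ _))
    fun m m' => h.map_add m m')) fun n r m => by
      change h m (σ.toFun r • n) = h (r • m) n
      rw [h.map_smul]
      rfl

/-- Characters of `N ⊗_R M` give `S`-linear maps from `N` to the dual of `M`. -/
def toHomLeft (c : Tens σ N M →+ AddCircle (1 : ℚ)) : N →ₗ[S] Dual σ M where
  toFun n := Dual.mk σ (c.comp (tmulHom σ n))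
  map_add' n n' := Dual.ext _ fun m => (congrArg c (add_tmul σ n n' m)).trans (c.map_add _ _)
  map_smul' s n := Dual.ext _ fun m => congrArg c (by
    change tmul σ (s • n) m = tmul σ n (σ.inv s • m)
    rw [← smul_tmul, σ.right_inv])

/-- The evaluation `c ⊗ m ↦ c m`. -/
def ev : Tens σ (Dual σ M) M →+ AddCircle (1 : ℚ) :=
  lift σ (AddMonoidHom.mk' (fun c => ((c : Dual σ M) : M →+ _)) fun _ _ => rfl) fun c r m => by
    change c (σ.inv (σ.toFun r) • m) = c (r • m)
    rw [σ.left_inv]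

@[simp] theorem ev_tmul (c : Dual σ M) (m : M) : ev σ (tmul σ c m) = c m := rfl

/-- The coordinates of an element of `N ⊗_R Rⁿ`. -/
def coord (n : ℕ) : Tens σ N (Fin n → R) →+ (Fin n → N) :=
  lift σ (AddMonoidHom.mk' (fun x => AddMonoidHom.mk' (fun r i => σ.toFun (r i) • x)
      fun r r' => funext fun i => by simp [σ.map_add, add_smul])
    fun x y => AddMonoidHom.ext fun r => funext fun i => by simp) fun x s r => funext fun i => by
      simp [σ.map_mul, mul_smul]

@[simp] theorem coord_tmul {n : ℕ} (x : N) (r : Fin n → R) (i : Fin n) :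
    coord σ n (tmul σ x r) i = σ.toFun (r i) • x := rfl

theorem eq_sum_coord {n : ℕ} (t : Tens σ N (Fin n → R)) :
    t = ∑ i, tmul σ (coord σ n t i) (Pi.single i 1) := by
  induction t using induction_on with
  | zero => simp [zero_tmul]
  | tmul x r =>
    simp_rw [coord_tmul, smul_tmul, ← tmul_sum]
    congr 1
    exact pi_eq_sum_univ' r
  | add s t hs ht =>
    conv_lhs => rw [hs, ht]
    simp [add_tmul, Finset.sum_add_distrib]

/-- Right exactness: if `p` is surjective, then the kernel of `N ⊗ p` is generated by the pure
tensors `n ⊗ k` with `k` in the kernel of `p`. -/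
theorem mem_closure_of_map_eq_zero {p : M →ₗ[R] M'} (hp : Function.Surjective p)
    {t : Tens σ N M} (ht : map σ LinearMap.id p t = 0) :
    t ∈ AddSubgroup.closure {x | ∃ (n : N) (k : M), p k = 0 ∧ x = tmul σ n k} := by
  set H := AddSubgroup.closure {x | ∃ (n : N) (k : M), p k = 0 ∧ x = tmul σ n k} with hH
  -- The map `n ⊗ p m ↦ n ⊗ m` modulo `H` is well defined and inverts `N ⊗ p`.
  let l := Function.surjInv hp
  have hl : ∀ m, p (l m) = m := Function.surjInv_eq hp
  have key : ∀ (n : N) (m m' : M), p m = p m' →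
      (QuotientAddGroup.mk (tmul σ n m) : _ ⧸ H) = QuotientAddGroup.mk (tmul σ n m') := by
    intro n m m' h
    refine QuotientAddGroup.eq_iff_sub_mem.2 ?_
    rw [← tmul_sub]
    exact AddSubgroup.subset_closure ⟨n, m - m', by rw [map_sub, h, sub_self], rfl⟩
  let φ : Tens σ N M' →+ Tens σ N M ⧸ H :=
    lift σ (AddMonoidHom.mk' (fun n => AddMonoidHom.mk' (fun m => QuotientAddGroup.mk (tmul σ n (l m)))
        fun m m' => (key n _ (l m + l m') (by simp only [map_add, hl])).trans
          (by rw [tmul_add]; rfl))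
      fun n n' => AddMonoidHom.ext fun m => by
        change QuotientAddGroup.mk (tmul σ (n + n') (l m)) = _
        rw [add_tmul]; rfl) fun n r m => by
        change QuotientAddGroup.mk (tmul σ (σ.toFun r • n) (l m)) =
          QuotientAddGroup.mk (tmul σ n (l (r • m)))
        rw [smul_tmul]
        exact key n _ _ (by simp only [map_smul, hl])
  have hφ : φ.comp (map σ LinearMap.id p) = QuotientAddGroup.mk' H :=
    hom_ext fun n m => key n _ _ (hl _)
  rw [← QuotientAddGroup.eq_zero_iff]
  exact (DFunLike.congr_fun hφ t).symm.trans (by simp [ht])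

theorem map_surjective {p : M →ₗ[R] M'} (hp : Function.Surjective p) :
    Function.Surjective (map σ (LinearMap.id : N →ₗ[S] N) p) := by
  intro t
  induction t using induction_on with
  | zero => exact ⟨0, map_zero _⟩
  | tmul n m =>
    obtain ⟨m, rfl⟩ := hp m
    exact ⟨tmul σ n m, rfl⟩
  | add s t hs ht =>
    obtain ⟨s, rfl⟩ := hs
    obtain ⟨t, rfl⟩ := ht
    exact ⟨s + t, map_add _ _ _⟩

/-- Only finitely many elements of the kernel of `p` are responsible for the vanishing of the image
of `t` under `N ⊗ p`. -/
theorem exists_finset_of_map_eq_zero {p : M →ₗ[R] M'} (hp : Function.Surjective p)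
    {t : Tens σ N M} (ht : map σ LinearMap.id p t = 0) :
    ∃ K : Finset M, (∀ k ∈ K, p k = 0) ∧ ∀ (G : Type u) [AddCommGroup G] [Module R G]
      (q : M →ₗ[R] G), (∀ k ∈ K, q k = 0) → map σ (LinearMap.id : N →ₗ[S] N) q t = 0 := by
  classical
  refine AddSubgroup.closure_induction
    (p := fun t _ => ∃ K : Finset M, (∀ k ∈ K, p k = 0) ∧
      ∀ (G : Type u) [AddCommGroup G] [Module R G] (q : M →ₗ[R] G), (∀ k ∈ K, q k = 0) →
        map σ (LinearMap.id : N →ₗ[S] N) q t = 0) ?_ ?_ ?_ ?_ (mem_closure_of_map_eq_zero σ hp ht)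
  · rintro _ ⟨n, k, hk, rfl⟩
    refine ⟨{k}, by simpa using hk, fun G _ _ q hq => ?_⟩
    rw [map_tmul, hq k (Finset.mem_singleton_self k), tmul_zero]
  · exact ⟨∅, by simp, fun G _ _ q _ => map_zero _⟩
  · rintro x y _ _ ⟨K, hK, hx⟩ ⟨L, hL, hy⟩
    refine ⟨K ∪ L, fun k hk => ?_, fun G _ _ q hq => ?_⟩
    · exact (Finset.mem_union.1 hk).elim (hK k) (hL k)
    · rw [map_add, hx G q fun k hk => hq k (Finset.mem_union_left _ hk),
        hy G q fun k hk => hq k (Finset.mem_union_right _ hk), add_zero]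
  · rintro x _ ⟨K, hK, hx⟩
    exact ⟨K, hK, fun G _ _ q hq => by rw [map_neg, hx G q hq, neg_zero]⟩

end Tens

end Tens

/-! ### Finiteness properties of the tensor product -/

section Finiteness

variable {R S : Type u} [Ring R] [Ring S] (σ : AntiEquiv R S)

variable {N N' N'' M M' M'' : Type u} [AddCommGroup N] [Module S N] [AddCommGroup N'] [Module S N']
  [AddCommGroup N''] [Module S N''] [AddCommGroup M] [Module R M] [AddCommGroup M'] [Module R M']
  [AddCommGroup M''] [Module R M'']

theorem finitePresentation_quotient_span (F : Type u) [AddCommGroup F] [Module R F]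
    [Module.FinitePresentation R F] {s : Set F} (hs : s.Finite) :
    Module.FinitePresentation R (F ⧸ Submodule.span R s) :=
  Module.finitePresentation_of_surjective (Submodule.span R s).mkQ (Submodule.mkQ_surjective _)
    (by rw [Submodule.ker_mkQ]; exact Submodule.fg_span hs)

theorem exists_comp_eq_of_ker_le {p : M →ₗ[R] M'} (hp : Function.Surjective p) (h : M →ₗ[R] M'')
    (hh : ∀ x, p x = 0 → h x = 0) : ∃ h' : M' →ₗ[R] M'', h' ∘ₗ p = h := by
  refine ⟨(LinearMap.ker p).liftQ h hh ∘ₗ (p.quotKerEquivOfSurjective hp).symm.toLinearMap, ?_⟩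
  refine LinearMap.ext fun x => ?_
  have : (p.quotKerEquivOfSurjective hp).symm (p x) = (LinearMap.ker p).mkQ x := by
    rw [LinearEquiv.symm_apply_eq]; rfl
  exact congrArg ((LinearMap.ker p).liftQ h hh) this

namespace Tens

theorem map_add_right (v : N →ₗ[S] N') (g g' : M →ₗ[R] M') (t : Tens σ N M) :
    map σ v (g + g') t = map σ v g t + map σ v g' t :=
  DFunLike.congr_fun (hom_ext (φ := map σ v (g + g')) (ψ := map σ v g + map σ v g')
    fun n m => tmul_add σ (v n) (g m) (g' m)) t

theorem map_add_left (v v' : N →ₗ[S] N') (g : M →ₗ[R] M') (t : Tens σ N M) :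
    map σ (v + v') g t = map σ v g t + map σ v' g t :=
  DFunLike.congr_fun (hom_ext (φ := map σ (v + v') g) (ψ := map σ v g + map σ v' g)
    fun n m => add_tmul σ (v n) (v' n) (g m)) t

theorem map_zero_right (v : N →ₗ[S] N') (t : Tens σ N M) :
    map σ v (0 : M →ₗ[R] M') t = 0 :=
  DFunLike.congr_fun (hom_ext (φ := map σ v (0 : M →ₗ[R] M')) (ψ := 0)
    fun n _ => tmul_zero σ (v n)) t

/-- Every element of a tensor product comes from a finitely presented module. -/
theorem exists_finitePresentation (t : Tens σ N M) :
    ∃ (F : Type u) (_ : AddCommGroup F) (_ : Module R F) (_ : Module.FinitePresentation R F)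
      (g : F →ₗ[R] M) (t' : Tens σ N F), map σ LinearMap.id g t' = t := by
  induction t using induction_on with
  | zero => exact ⟨R, inferInstance, inferInstance, inferInstance, 0, 0, map_zero _⟩
  | tmul n m =>
    exact ⟨R, inferInstance, inferInstance, inferInstance, LinearMap.toSpanSingleton R M m,
      tmul σ n 1, by simp⟩
  | add s t hs ht =>
    obtain ⟨F, _, _, _, g, s', rfl⟩ := hs
    obtain ⟨G, _, _, _, h, t', rfl⟩ := ht
    refine ⟨F × G, inferInstance, inferInstance, inferInstance, g.coprod h,
      map σ LinearMap.id (LinearMap.inl R F G) s' + map σ LinearMap.id (LinearMap.inr R F G) t', ?_⟩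
    rw [map_add, map_map, map_map]
    simp

/-- If the image of `t ∈ N ⊗ A` in `N ⊗ M` vanishes, where `A` is finitely presented, then it
vanishes already in `N ⊗ B` for a finitely presented module `B` through which `A → M` factors. -/
theorem exists_factorization {A : Type u} [AddCommGroup A] [Module R A]
    [Module.FinitePresentation R A] (g : A →ₗ[R] M) (t : Tens σ N A)
    (ht : map σ LinearMap.id g t = 0) :
    ∃ (B : Type u) (_ : AddCommGroup B) (_ : Module R B) (_ : Module.FinitePresentation R B)
      (f : A →ₗ[R] B) (g' : B →ₗ[R] M), g' ∘ₗ f = g ∧ map σ LinearMap.id f t = 0 := by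
  classical
  -- Cover `M` by `A ⊕ R^(M)` and impose on `A ⊕ R^s` the finitely many relations that matter.
  let p : A × (M →₀ R) →ₗ[R] M := g.coprod (Finsupp.linearCombination R id)
  have hp : Function.Surjective p := fun m => ⟨(0, Finsupp.single m 1), by simp [p]⟩
  have hpt : map σ LinearMap.id p (map σ LinearMap.id (LinearMap.inl R A (M →₀ R)) t) = 0 := by
    rw [map_map]
    simpa [p] using ht
  obtain ⟨K, hK, hKt⟩ := exists_finset_of_map_eq_zero σ hp hpt
  let s : Finset M := K.biUnion fun k => k.2.support
  let ρ : A × (M →₀ R) →ₗ[R] A × (s → R) :=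
    LinearMap.prodMap LinearMap.id (LinearMap.pi fun x => Finsupp.lapply x.1)
  let p' : A × (s → R) →ₗ[R] M := g.coprod (Fintype.linearCombination R Subtype.val)
  have hp' : ∀ k ∈ K, p' (ρ k) = 0 := by
    intro k hk
    rw [← hK k hk]
    simp only [p', p, ρ, LinearMap.coprod_apply, LinearMap.prodMap_apply, LinearMap.id_apply,
      Fintype.linearCombination_apply, LinearMap.pi_apply, Finsupp.lapply_apply,
      Finsupp.linearCombination_apply, id]
    congr 1
    rw [Finsupp.sum_of_support_subset k.2 (Finset.subset_biUnion_of_mem (fun k => k.2.support) hk)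
      _ (by simp)]
    exact Finset.sum_coe_sort s fun x => k.2 x • x
  refine ⟨_ ⧸ Submodule.span R (ρ '' K), inferInstance, inferInstance,
    finitePresentation_quotient_span _ (K.finite_toSet.image ρ),
    (Submodule.span R (ρ '' K)).mkQ ∘ₗ LinearMap.inl R A (s → R),
    (Submodule.span R (ρ '' K)).liftQ p' ?_, ?_, ?_⟩
  · rw [Submodule.span_le]
    rintro _ ⟨k, hk, rfl⟩
    exact hp' k hk
  · ext a
    simp [p']
  · have := hKt _ ((Submodule.span R (ρ '' K)).mkQ ∘ₗ ρ) fun k hk =>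
      (Submodule.Quotient.mk_eq_zero _).2 (Submodule.subset_span ⟨k, hk, rfl⟩)
    rw [map_map] at this
    have e : ρ ∘ₗ LinearMap.inl R A (M →₀ R) = LinearMap.inl R A (s → R) := by
      ext a <;> simp [ρ]
    rwa [LinearMap.comp_assoc, e] at this

/-! ### Duality between tensor products and Hom groups -/

/-- The pairing of `M⁺ ⊗ A` with `Hom(A, M)`. -/
def pair (t : Tens σ (Dual σ M) M') : (M' →ₗ[R] M) →+ AddCircle (1 : ℚ) :=
  AddMonoidHom.mk' (fun h => ev σ (map σ LinearMap.id h t)) fun h h' => by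
    rw [map_add_right, _root_.map_add]

theorem pair_apply (t : Tens σ (Dual σ M) M') (h : M' →ₗ[R] M) :
    pair σ t h = ev σ (map σ LinearMap.id h t) := rfl

@[simp] theorem pair_tmul (c : Dual σ M) (x : M') (h : M' →ₗ[R] M) :
    pair σ (tmul σ c x) h = c (h x) := rfl

theorem pair_add (t t' : Tens σ (Dual σ M) M') (h : M' →ₗ[R] M) :
    pair σ (t + t') h = pair σ t h + pair σ t' h := by
  rw [pair_apply, _root_.map_add, _root_.map_add]; rfl

theorem pair_sub (t t' : Tens σ (Dual σ M) M') (h : M' →ₗ[R] M) :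
    pair σ (t - t') h = pair σ t h - pair σ t' h := by
  rw [pair_apply, _root_.map_sub, _root_.map_sub]; rfl

theorem pair_map (t : Tens σ (Dual σ M) M') (f : M' →ₗ[R] M'') (h : M'' →ₗ[R] M) :
    pair σ (map σ LinearMap.id f t) h = pair σ t (h ∘ₗ f) := by
  rw [pair_apply, map_map]; rfl

theorem pair_surjective {A : Type u} [AddCommGroup A] [Module R A] [Module.Finite R A]
    (φ : (A →ₗ[R] M) →+ AddCircle (1 : ℚ)) :
    ∃ t : Tens σ (Dual σ M) A, ∀ h, pair σ t h = φ h := by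
  obtain ⟨n, p, hp⟩ := Module.Finite.exists_fin' R A
  obtain ⟨ψ, hψ⟩ := exists_character_comp_eq
    (AddMonoidHom.mk' (fun h : A →ₗ[R] M => h ∘ₗ p) fun _ _ => rfl) φ fun h hh => by
      rw [show h = 0 from LinearMap.ext fun a => by
        obtain ⟨x, rfl⟩ := hp a
        exact DFunLike.congr_fun hh x, map_zero]
  let c (i : Fin n) : M →+ AddCircle (1 : ℚ) := ψ.comp (AddMonoidHom.mk'
    (fun m => LinearMap.toSpanSingleton R M m ∘ₗ LinearMap.proj (φ := fun _ : Fin n => R) i)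
    fun m m' => LinearMap.ext fun x => by simp)
  refine ⟨∑ i, tmul σ (Dual.mk σ (c i)) (p (Pi.single i 1)), fun h => ?_⟩
  rw [pair_apply, map_sum, map_sum, ← hψ]
  simp only [map_tmul, ev_tmul, LinearMap.id_apply, Dual.mk_apply, c]
  simp only [AddMonoidHom.comp_apply, ← map_sum]
  congr 1
  refine LinearMap.pi_ext' fun i => LinearMap.ext_ring ?_
  simp [Pi.single_apply]

theorem pair_proj (n : ℕ) (t : Tens σ (Dual σ M) (Fin n → R)) (i : Fin n) (m : M) :
    pair σ t (LinearMap.toSpanSingleton R M m ∘ₗ LinearMap.proj i) = coord σ n t i m := by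
  induction t using induction_on with
  | zero => simp [pair_apply]
  | tmul c r => simp [σ.left_inv]
  | add s t hs ht => rw [pair_add, hs, ht, _root_.map_add]; rfl

/-- For a finitely presented module `A` the pairing identifies `M⁺ ⊗ A` with the group of characters
of `Hom(A, M)`; this is its injectivity. -/
theorem eq_zero_of_pair {A : Type u} [AddCommGroup A] [Module R A] [Module.FinitePresentation R A]
    (t : Tens σ (Dual σ M) A) (ht : ∀ h, pair σ t h = 0) : t = 0 := by
  have free (n : ℕ) (t : Tens σ (Dual σ M) (Fin n → R)) (ht : ∀ h, pair σ t h = 0) : t = 0 := by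
    rw [eq_sum_coord σ t]
    refine Finset.sum_eq_zero fun i _ => ?_
    rw [show coord σ n t i = 0 from Dual.ext σ fun m => by rw [← pair_proj, ht]; rfl, zero_tmul]
  obtain ⟨n, p, hp⟩ := Module.Finite.exists_fin' R A
  have : Module.Finite R (LinearMap.ker p) :=
    Module.Finite.of_fg (Module.FinitePresentation.fg_ker p hp)
  obtain ⟨t, rfl⟩ := map_surjective σ hp t
  -- The character of `Hom(Rⁿ, M)` given by `t` comes from one of `Hom(ker p, M)`.
  obtain ⟨d, hd⟩ := exists_character_comp_eq
    (AddMonoidHom.mk' (fun h : (Fin n → R) →ₗ[R] M => h ∘ₗ (LinearMap.ker p).subtype)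
      fun _ _ => rfl) (pair σ t) fun h hh => by
        obtain ⟨h', rfl⟩ := exists_comp_eq_of_ker_le hp h fun x hx =>
          DFunLike.congr_fun hh ⟨x, hx⟩
        rw [← pair_map, ht]
  obtain ⟨s, hs⟩ := pair_surjective σ d
  have : t = map σ LinearMap.id (LinearMap.ker p).subtype s := by
    refine sub_eq_zero.1 (free n _ fun h => ?_)
    rw [pair_sub, pair_map, hs, ← hd, sub_eq_zero]; rfl
  rw [this, map_map, show p ∘ₗ (LinearMap.ker p).subtype = 0 from LinearMap.ext fun x => x.2]
  exact map_zero_right σ _ s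

end Tens

/-- `M` is injective with respect to `f : X → Y`: every map `X → M` extends along `f`. -/
def Extends {X Y : Type u} [AddCommGroup X] [Module R X] [AddCommGroup Y] [Module R Y]
    (f : X →ₗ[R] Y) (M : Type u) [AddCommGroup M] [Module R M] : Prop :=
  ∀ h : X →ₗ[R] M, ∃ k : Y →ₗ[R] M, k ∘ₗ f = h

open Tens

variable {X Y : Type u} [AddCommGroup X] [Module R X] [AddCommGroup Y] [Module R Y]

/-- Both sides say that `Hom(Y, M) → Hom(X, M)` is surjective, as `M⁺ ⊗ f` is its transpose. -/
theorem extends_iff_map_dual_injective [Module.FinitePresentation R X]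
    [Module.FinitePresentation R Y] (f : X →ₗ[R] Y) :
    Extends f M ↔ ∀ t : Tens σ (Dual σ M) X, Tens.map σ LinearMap.id f t = 0 → t = 0 := by
  refine ⟨fun H t ht => eq_zero_of_pair σ t fun h => ?_, fun H h => ?_⟩
  · obtain ⟨k, rfl⟩ := H h
    rw [← pair_map, ht, pair_apply, map_zero, map_zero]
  · by_contra hh
    obtain ⟨φ, hφ, hφh⟩ := exists_character_of_notMem_range
      (AddMonoidHom.mk' (fun k : Y →ₗ[R] M => k ∘ₗ f) fun _ _ => rfl) h hh
    obtain ⟨t, ht⟩ := pair_surjective σ φ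
    refine hφh ?_
    rw [← ht, H t, pair_apply, map_zero, map_zero]
    refine eq_zero_of_pair σ _ fun k => ?_
    rw [pair_map, ht]
    exact hφ k

/-- Both sides say that `N ⊗ f` is injective, as its transpose is `Hom(Y, N⁺) → Hom(X, N⁺)`. -/
theorem map_injective_iff_extends_dual (f : X →ₗ[R] Y) :
    (∀ t : Tens σ N X, Tens.map σ LinearMap.id f t = 0 → t = 0) ↔
      Extends f (Dual σ.symm N) := by
  refine ⟨fun H h => ?_, fun H t ht => ?_⟩
  · obtain ⟨d, hd⟩ := exists_character_comp_eq (Tens.map σ (LinearMap.id : N →ₗ[S] N) f)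
      (ofHomRight σ h) fun t ht => by rw [H t ht, map_zero]
    exact ⟨toHomRight σ d, LinearMap.ext fun x => Dual.ext _ fun n => hd (tmul σ n x)⟩
  · refine CharacterModule.eq_zero_of_character_apply fun c => ?_
    obtain ⟨k, hk⟩ := H (toHomRight σ c)
    have : (ofHomRight σ k).comp (Tens.map σ LinearMap.id f) = c :=
      hom_ext fun n x => DFunLike.congr_fun (DFunLike.congr_fun hk x) n
    exact (DFunLike.congr_fun this t).symm.trans (by simp [ht])

/-- A module and its double dual are injective with respect to the same maps between finitely
presented modules. -/
theorem extends_iff_extends_bidual [Module.FinitePresentation R X]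
    [Module.FinitePresentation R Y] (f : X →ₗ[R] Y) :
    Extends f M ↔ Extends f (Dual σ.symm (Dual σ M)) :=
  (extends_iff_map_dual_injective σ f).trans (map_injective_iff_extends_dual σ f)

/-- A module is pure in its double dual. -/
theorem exists_extension_of_eval [Module.FinitePresentation R X]
    [Module.FinitePresentation R Y] (f : X →ₗ[R] Y) (h : X →ₗ[R] M)
    (k : Y →ₗ[R] Dual σ.symm (Dual σ M)) (hk : k ∘ₗ f = Dual.eval σ M ∘ₗ h) :
    ∃ k' : Y →ₗ[R] M, k' ∘ₗ f = h := by
  by_contra hh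
  obtain ⟨φ, hφ, hφh⟩ := exists_character_of_notMem_range
    (AddMonoidHom.mk' (fun k : Y →ₗ[R] M => k ∘ₗ f) fun _ _ => rfl) h hh
  obtain ⟨t, ht⟩ := pair_surjective σ φ
  refine hφh ?_
  have hft : Tens.map σ LinearMap.id f t = 0 := eq_zero_of_pair σ _ fun k => by
    rw [pair_map, ht]
    exact hφ k
  have : (ev σ).comp (Tens.map σ LinearMap.id h) =
      (ofHomRight σ k).comp (Tens.map σ LinearMap.id f) :=
    hom_ext fun n x => (DFunLike.congr_fun (DFunLike.congr_fun hk x) n).symm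
  rw [← ht]
  exact (DFunLike.congr_fun this t).trans (by simp [hft])

/-! ### The universal element of the kernel of `N ⊗ f` -/

/-- For `t ∈ A' ⊗ A` with `A'` and `A` finitely presented, the functor of those maps `u` out of `A'`
that kill `t` is finitely generated. -/
theorem exists_map_eq_zero_iff {A' A : Type u} [AddCommGroup A'] [Module S A'] [AddCommGroup A]
    [Module R A] [Module.FinitePresentation S A'] [Module.FinitePresentation R A]
    (t : Tens σ A' A) :
    ∃ (B' : Type u) (_ : AddCommGroup B') (_ : Module S B') (_ : Module.FinitePresentation S B')
      (f' : A' →ₗ[S] B'), ∀ (N : Type u) [AddCommGroup N] [Module S N] (u : A' →ₗ[S] N),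
        Tens.map σ u LinearMap.id t = 0 ↔ ∃ v : B' →ₗ[S] N, v ∘ₗ f' = u := by
  classical
  obtain ⟨n, p, hp⟩ := Module.Finite.exists_fin' R A
  obtain ⟨K, hK⟩ := Module.FinitePresentation.fg_ker p hp
  obtain ⟨t, rfl⟩ := map_surjective σ hp t
  -- With `t = ∑ xᵢ ⊗ p eᵢ`, the map `u` kills `t` iff there are `y_k`, for `k` in the set `K` of
  -- generators of the kernel of `p`, such that `u xᵢ = ∑ y_k kᵢ` for all `i`.
  have key (N : Type u) [AddCommGroup N] [Module S N] (u : A' →ₗ[S] N) :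
      Tens.map σ u LinearMap.id (Tens.map σ LinearMap.id p t) = 0 ↔
        ∃ y : K → N, ∀ i, u (coord σ n t i) = ∑ k : K, σ.toFun (k.1 i) • y k := by
    have hcoord : ∀ i, coord σ n (Tens.map σ u LinearMap.id t) i = u (coord σ n t i) := by
      intro i
      have : (Pi.evalAddMonoidHom _ i).comp ((coord σ n).comp (Tens.map σ u LinearMap.id)) =
          u.toAddMonoidHom.comp ((Pi.evalAddMonoidHom _ i).comp (coord σ n)) :=
        hom_ext fun x r => (u.map_smul _ _).symm
      exact DFunLike.congr_fun this t
    have hcomm : Tens.map σ u LinearMap.id (Tens.map σ LinearMap.id p t) =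
        Tens.map σ LinearMap.id p (Tens.map σ u LinearMap.id t) := by
      rw [map_map, map_map]; rfl
    rw [hcomm]
    constructor
    · intro h
      suffices ∀ s ∈ AddSubgroup.closure
          {x : Tens σ N (Fin n → R) | ∃ (m : N) (k : Fin n → R), p k = 0 ∧ x = tmul σ m k},
          ∃ y : K → N, ∀ i, coord σ n s i = ∑ k : K, σ.toFun (k.1 i) • y k by
        obtain ⟨y, hy⟩ := this _ (mem_closure_of_map_eq_zero σ hp h)
        exact ⟨y, fun i => by rw [← hcoord, hy]⟩
      intro s hs
      induction hs using AddSubgroup.closure_induction with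
      | mem x hx =>
        obtain ⟨m, k, hk, rfl⟩ := hx
        have hk' : k ∈ Submodule.span R (K : Set (Fin n → R)) := by rw [hK]; exact hk
        obtain ⟨c, hc⟩ := Submodule.mem_span_finset'.1 hk'
        refine ⟨fun k => σ.toFun (c k) • m, fun i => ?_⟩
        simp_rw [coord_tmul, ← hc, Finset.sum_apply, σ.map_sum, Finset.sum_smul, smul_smul,
          ← σ.map_mul]
        rfl
      | zero => exact ⟨0, fun i => by simp⟩
      | add x y _ _ hx hy =>
        obtain ⟨a, ha⟩ := hx
        obtain ⟨b, hb⟩ := hy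
        exact ⟨a + b, fun i => by simp [ha, hb, Finset.sum_add_distrib]⟩
      | neg x _ hx =>
        obtain ⟨a, ha⟩ := hx
        exact ⟨-a, fun i => by simp [ha]⟩
    · rintro ⟨y, hy⟩
      rw [eq_sum_coord σ (Tens.map σ u LinearMap.id t)]
      simp_rw [hcoord, hy, map_sum, map_tmul, LinearMap.id_apply, sum_tmul, smul_tmul]
      rw [Finset.sum_comm]
      refine Finset.sum_eq_zero fun k _ => ?_
      have hk : p k.1 = 0 := by
        change k.1 ∈ LinearMap.ker p
        rw [← hK]; exact Submodule.subset_span k.2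
      rw [← tmul_sum, ← tmul_zero σ (y k), ← hk]
      congr 1
      conv_rhs => rw [pi_eq_sum_univ' k.1]
      simp_rw [map_sum, map_smul]
  let w (i : Fin n) : A' × (K → S) := (coord σ n t i, fun k => -σ.toFun (k.1 i))
  refine ⟨(A' × (K → S)) ⧸ Submodule.span S (Set.range w), inferInstance, inferInstance,
    finitePresentation_quotient_span _ (Set.finite_range w),
    (Submodule.span S (Set.range w)).mkQ ∘ₗ LinearMap.inl S A' (K → S), fun N _ _ u => ?_⟩
  rw [key]
  constructor
  · rintro ⟨y, hy⟩
    refine ⟨(Submodule.span S (Set.range w)).liftQ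
      (u.coprod (Fintype.linearCombination S y)) ?_, ?_⟩
    · rw [Submodule.span_le]
      rintro _ ⟨i, rfl⟩
      simp [w, hy, Fintype.linearCombination_apply]
    · ext a
      simp
  · rintro ⟨v, rfl⟩
    refine ⟨fun k => v (Submodule.Quotient.mk (0, Pi.single k 1)), fun i => ?_⟩
    have hw : (Submodule.span S (Set.range w)).mkQ (w i) = 0 :=
      (Submodule.Quotient.mk_eq_zero _).2 (Submodule.subset_span ⟨i, rfl⟩)
    have hw' : w i = (coord σ n t i, 0) -
        ∑ k : K, σ.toFun (k.1 i) • ((0, Pi.single k 1) : A' × (K → S)) := by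
      refine Prod.ext ?_ ?_
      · simp [w, Prod.fst_sum]
      · simp only [w, Prod.snd_sub, Prod.snd_sum, Prod.smul_snd, zero_sub]
        rw [← pi_eq_sum_univ' (fun k : K => σ.toFun (k.1 i))]
        rfl
    rw [hw', map_sub, sub_eq_zero, map_sum] at hw
    refine (congrArg v hw).trans ?_
    rw [map_sum]
    exact Finset.sum_congr rfl fun k _ => by rw [map_smul, map_smul]; rfl

/-- For a map `f` between finitely presented modules, the functor `N ↦ ker (N ⊗ f)` has a
presentation `Hom(B', -) → Hom(A', -) → ker (- ⊗ f) → 0` on all modules; `t` is the element of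
`ker (A' ⊗ f)` to which the second map belongs by the Yoneda lemma. -/
theorem exists_presentation_ker {A B : Type u} [AddCommGroup A] [Module R A] [AddCommGroup B]
    [Module R B] [Module.FinitePresentation R A] [Module.FinitePresentation R B]
    (f : A →ₗ[R] B) :
    ∃ (A' : Type u) (_ : AddCommGroup A') (_ : Module S A') (_ : Module.FinitePresentation S A')
      (B' : Type u) (_ : AddCommGroup B') (_ : Module S B') (_ : Module.FinitePresentation S B')
      (f' : A' →ₗ[S] B') (t : Tens σ A' A), Tens.map σ LinearMap.id f t = 0 ∧
      (∀ (N : Type u) [AddCommGroup N] [Module S N] (s : Tens σ N A),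
        Tens.map σ LinearMap.id f s = 0 → ∃ u : A' →ₗ[S] N, Tens.map σ u LinearMap.id t = s) ∧
      (∀ (N : Type u) [AddCommGroup N] [Module S N] (u : A' →ₗ[S] N),
        Tens.map σ u LinearMap.id t = 0 ↔ ∃ v : B' →ₗ[S] N, v ∘ₗ f' = u) := by
  obtain ⟨n, p, hp⟩ := Module.Finite.exists_fin' R A
  -- Every element of `N ⊗ A` is the image of `t₀` under a map `Sⁿ → N`.
  let t₀ : Tens σ (Fin n → S) A := ∑ i, tmul σ (Pi.single i 1) (p (Pi.single i 1))
  have ht₀ (N : Type u) [AddCommGroup N] [Module S N] (s : Tens σ N A) :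
      ∃ z : (Fin n → S) →ₗ[S] N, Tens.map σ z LinearMap.id t₀ = s := by
    obtain ⟨s, rfl⟩ := map_surjective σ hp s
    refine ⟨Fintype.linearCombination S (coord σ n s), ?_⟩
    conv_rhs => rw [eq_sum_coord σ s]
    simp [t₀]
  obtain ⟨A', _, _, _, g, hg⟩ := exists_map_eq_zero_iff σ (Tens.map σ LinearMap.id f t₀)
  let t := Tens.map σ g LinearMap.id t₀
  obtain ⟨B', _, _, _, f', hf'⟩ := exists_map_eq_zero_iff σ t
  have hcomm (N : Type u) [AddCommGroup N] [Module S N] (z : (Fin n → S) →ₗ[S] N) :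
      Tens.map σ LinearMap.id f (Tens.map σ z LinearMap.id t₀) =
        Tens.map σ z LinearMap.id (Tens.map σ LinearMap.id f t₀) := by
    rw [map_map, map_map]; rfl
  refine ⟨A', inferInstance, inferInstance, inferInstance, B', inferInstance, inferInstance,
    inferInstance, f', t, ?_, fun N _ _ s hs => ?_, hf'⟩
  · exact (hcomm A' g).trans ((hg A' g).2 ⟨LinearMap.id, rfl⟩)
  · obtain ⟨z, rfl⟩ := ht₀ N s
    rw [hcomm] at hs
    obtain ⟨u, rfl⟩ := (hg N z).1 hs
    refine ⟨u, ?_⟩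
    rw [map_map]; rfl

/-! ### Pure embeddings and pure quotients -/

/-- `j` is a pure embedding: for every `f : X → Y` between finitely presented modules, a map from `X`
to the source of `j` extends along `f` as soon as its composite with `j` does. With `Y = 0` and
`X = R` this contains the injectivity of `j`. -/
def IsPureMap (j : M →ₗ[R] M') : Prop :=
  ∀ (X Y : Type u) [AddCommGroup X] [Module R X] [AddCommGroup Y] [Module R Y]
    [Module.FinitePresentation R X] [Module.FinitePresentation R Y] (f : X →ₗ[R] Y)
    (h : X →ₗ[R] M) (k : Y →ₗ[R] M'), k ∘ₗ f = j ∘ₗ h → ∃ k' : Y →ₗ[R] M, k' ∘ₗ f = h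

theorem IsPureMap.map_injective {j : M →ₗ[R] M'} (hj : IsPureMap j) (t : Tens σ N M)
    (ht : Tens.map σ LinearMap.id j t = 0) : t = 0 := by
  obtain ⟨F, _, _, _, g, t, rfl⟩ := exists_finitePresentation σ t
  rw [map_map] at ht
  obtain ⟨B, _, _, _, f, k, hk, hf⟩ := exists_factorization σ _ t ht
  obtain ⟨k', rfl⟩ := hj F B f g k hk
  have := congrArg (Tens.map σ LinearMap.id k') hf
  rwa [map_map, map_zero] at this

/-- The transpose of a pure embedding is a split surjection. -/
theorem IsPureMap.exists_section {j : M →ₗ[R] M'} (hj : IsPureMap j) :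
    ∃ s : Dual σ M →ₗ[S] Dual σ M', Dual.map σ j ∘ₗ s = LinearMap.id := by
  obtain ⟨χ, hχ⟩ := exists_character_comp_eq
    (Tens.map σ (LinearMap.id : Dual σ M →ₗ[S] Dual σ M) j) (ev σ) fun t ht => by
      rw [hj.map_injective σ t ht, map_zero]
  exact ⟨toHomLeft σ χ, LinearMap.ext fun c => Dual.ext σ fun m => hχ (tmul σ c m)⟩

/-- The transpose of a pure epimorphism is a split injection. -/
theorem exists_retraction_dual_map (g : M →ₗ[R] M')
    (hg : ∀ (X : Type u) [AddCommGroup X] [Module R X] [Module.FinitePresentation R X]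
      (h : X →ₗ[R] M'), ∃ h' : X →ₗ[R] M, g ∘ₗ h' = h) :
    ∃ r : Dual σ M →ₗ[S] Dual σ M', r ∘ₗ Dual.map σ g = LinearMap.id := by
  have inj (t : Tens σ (Dual σ M') M') (ht : Tens.map σ (Dual.map σ g) LinearMap.id t = 0) :
      t = 0 := by
    obtain ⟨F, _, _, _, a, t, rfl⟩ := exists_finitePresentation σ t
    have ht' : Tens.map σ LinearMap.id a (Tens.map σ (Dual.map σ g) LinearMap.id t) = 0 := by
      rw [map_map] at ht ⊢
      exact ht
    obtain ⟨B, _, _, _, f, a', rfl, hf⟩ := exists_factorization σ _ _ ht'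
    have : Tens.map σ LinearMap.id f t = 0 := eq_zero_of_pair σ _ fun h => by
      obtain ⟨e, rfl⟩ := hg B h
      have adj : (ev σ).comp (Tens.map σ LinearMap.id (g ∘ₗ e)) =
          ((ev σ).comp (Tens.map σ LinearMap.id e)).comp
            (Tens.map σ (Dual.map σ g) LinearMap.id) := hom_ext fun _ _ => rfl
      refine (DFunLike.congr_fun adj _).trans ?_
      rw [map_map] at hf
      simp only [AddMonoidHom.comp_apply]
      rw [map_map (g := f)]
      exact (congrArg _ (congrArg _ hf)).trans (by simp)
    have := congrArg (Tens.map σ LinearMap.id a') this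
    rwa [map_map, map_zero] at this
  obtain ⟨χ, hχ⟩ := exists_character_comp_eq
    (Tens.map σ (Dual.map σ g) (LinearMap.id : M' →ₗ[R] M')) (ev σ) fun t ht => by
      rw [inj t ht, map_zero]
  exact ⟨toHomLeft σ χ, LinearMap.ext fun c => Dual.ext σ fun m => hχ (tmul σ c m)⟩

end Finiteness

/-! ### Finitely presented functors and their generators -/

section Functors

variable {R S : Type u} [Ring R] [Ring S]

theorem shortComplex_exact_of_evaluation {C : Type (u + 1)} [Category.{u} C]
    (T : ShortComplex (C ⥤ AddCommGrpCat.{u + 1}))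
    (h : ∀ X, (T.map ((evaluation _ _).obj X)).Exact) : T.Exact := by
  rw [ShortComplex.exact_iff_isZero_homology, Functor.isZero_iff]
  intro X
  have := (ShortComplex.exact_iff_isZero_homology _).1 (h X)
  exact this.of_iso (T.mapHomologyIso ((evaluation _ _).obj X)).symm

namespace FunctorPresentation

variable {Q : FPMod R ⥤ AddCommGrpCat.{u + 1}} (P : FunctorPresentation Q)

/-- The element of `Q(A)` that corresponds to `Hom(A, -) ⟶ Q` under the Yoneda lemma. -/
def gen : Q.obj P.A := P.π.app P.A (ULift.up (𝟙 P.A))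

theorem π_app {X : FPMod R} (v : P.A ⟶ X) : P.π.app X (ULift.up v) = Q.map v P.gen := by
  have := ConcreteCategory.congr_hom (P.π.naturality v) (ULift.up (𝟙 P.A))
  refine Eq.trans ?_ this
  refine congrArg (P.π.app X) (congrArg ULift.up ?_)
  exact (Category.id_comp v).symm

theorem exists_map_gen {X : FPMod R} (x : Q.obj X) : ∃ v : P.A ⟶ X, Q.map v P.gen = x := by
  have := P.epi
  obtain ⟨v, rfl⟩ := (AddCommGrpCat.epi_iff_surjective (P.π.app X)).1 inferInstance x
  exact ⟨v.down, (P.π_app v.down).symm⟩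

theorem map_gen_eq_zero_iff {X : FPMod R} (v : P.A ⟶ X) :
    Q.map v P.gen = 0 ↔ ∃ w : P.B ⟶ X, P.f ≫ w = v := by
  rw [← P.π_app]
  constructor
  · intro h
    have ex := P.exact.map ((evaluation _ _).obj X)
    rw [ShortComplex.ab_exact_iff] at ex
    obtain ⟨w, hw⟩ := ex (ULift.up v) h
    exact ⟨w.down, congrArg ULift.down hw⟩
  · rintro ⟨w, rfl⟩
    exact ConcreteCategory.congr_hom (NatTrans.congr_app P.comp_zero X) (ULift.up w)

theorem map_add_apply (F : FPMod R ⥤ AddCommGrpCat.{u + 1}) [F.Additive] {A X : FPMod R}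
    (v w : A ⟶ X) (x : F.obj A) : F.map (v + w) x = F.map v x + F.map w x := by
  rw [F.map_add]; rfl

theorem map_comp_apply (F : FPMod R ⥤ AddCommGrpCat.{u + 1}) {A X Y : FPMod R}
    (v : A ⟶ X) (w : X ⟶ Y) (x : F.obj A) : F.map (v ≫ w) x = F.map w (F.map v x) := by
  rw [F.map_comp]; rfl

/-- The natural transformation out of `Hom(A, -)` that belongs to an element of `F(A)`. -/
def yonedaMap (F : FPMod R ⥤ AddCommGrpCat.{u + 1}) [F.Additive] {A : FPMod R} (x : F.obj A) :
    (homFunctor (FPMod R)).obj (op A) ⟶ F where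
  app X := AddCommGrpCat.ofHom (AddMonoidHom.mk' (fun v : ULift (A ⟶ X) => F.map v.down x)
    fun v w => map_add_apply F v.down w.down x)
  naturality _ _ v :=
    AddCommGrpCat.hom_ext (AddMonoidHom.ext fun w => map_comp_apply F w.down v x)

/-- A natural transformation out of `Q` may be prescribed on the generator by any element of `F(A)`
that `f` annihilates. -/
theorem exists_desc {F : FPMod R ⥤ AddCommGrpCat.{u + 1}} [F.Additive] (x : F.obj P.A)
    (hx : F.map P.f x = 0) : ∃ θ : Q ⟶ F, θ.app P.A P.gen = x := by
  have := P.epi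
  have h : (homFunctor (FPMod R)).map P.f.op ≫ yonedaMap F x = 0 := by
    ext X v
    refine (map_comp_apply F P.f v.down x).trans ?_
    rw [hx, map_zero]
    rfl
  refine ⟨P.exact.desc (yonedaMap F x) h, ?_⟩
  have := ConcreteCategory.congr_hom
    (NatTrans.congr_app (P.exact.g_desc (yonedaMap F x) h) P.A) (ULift.up (𝟙 P.A))
  refine this.trans ?_
  change F.map (𝟙 P.A) x = x
  rw [F.map_id]; rfl

theorem hom_ext_gen {F : FPMod R ⥤ AddCommGrpCat.{u + 1}} {θ θ' : Q ⟶ F}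
    (h : θ.app P.A P.gen = θ'.app P.A P.gen) : θ = θ' := by
  ext X x
  obtain ⟨v, rfl⟩ := P.exists_map_gen x
  have e := ConcreteCategory.congr_hom (θ.naturality v) P.gen
  have e' := ConcreteCategory.congr_hom (θ'.naturality v) P.gen
  exact e.trans ((congrArg (F.map v) h).trans e'.symm)

theorem map_f_gen : Q.map P.f P.gen = 0 := (P.map_gen_eq_zero_iff P.f).2 ⟨𝟙 _, Category.comp_id _⟩

/-- A presentation of `Q` from a generator `x` of `Q` and a map `f` that generates the maps
annihilating `x`. -/
theorem exists_of_generator {Q : FPMod R ⥤ AddCommGrpCat.{u + 1}} [Q.Additive] {A B : FPMod R}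
    (f : A ⟶ B) (x : Q.obj A) (hx : ∀ (X : FPMod R) (y : Q.obj X), ∃ v : A ⟶ X, Q.map v x = y)
    (hf : ∀ (X : FPMod R) (v : A ⟶ X), Q.map v x = 0 ↔ ∃ w : B ⟶ X, f ≫ w = v) :
    ∃ P : FunctorPresentation Q, ∀ M : ModuleCat.{u} R,
      Extends P.f.hom.hom M ↔ Extends f.hom.hom M := by
  refine ⟨⟨f, yonedaMap Q x, ?_, ?_, ?_⟩, fun _ => Iff.rfl⟩
  · ext X v
    exact (hf X _).2 ⟨v.down, rfl⟩
  · refine shortComplex_exact_of_evaluation _ fun X => ?_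
    rw [ShortComplex.ab_exact_iff]
    intro v hv
    obtain ⟨w, hw⟩ := (hf X v.down).1 hv
    exact ⟨ULift.up w, congrArg ULift.up hw⟩
  · rw [NatTrans.epi_iff_epi_app]
    intro X
    rw [AddCommGrpCat.epi_iff_surjective]
    intro y
    obtain ⟨v, hv⟩ := hx X y
    exact ⟨ULift.up v, hv⟩

/-- The extension of `Q` vanishes at `M` iff every map `A ⟶ M` extends along `A ⟶ B`. -/
theorem isZero_extension_obj_iff (M : ModuleCat.{u} R) :
    IsZero (P.extension.obj M) ↔ Extends P.f.hom.hom M := by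
  let η := (homFunctor (ModuleCat.{u} R)).map ((FPMod.incl R).map P.f).op
  have e : P.extension.obj M ≅ cokernel (η.app M) :=
    PreservesCokernel.iso ((evaluation (ModuleCat.{u} R) AddCommGrpCat.{u + 1}).obj M) η
  rw [e.isZero_iff, ← Preadditive.epi_iff_isZero_cokernel, AddCommGrpCat.epi_iff_surjective]
  constructor
  · intro h g
    obtain ⟨k, hk⟩ := h (ULift.up (ModuleCat.ofHom g))
    exact ⟨k.down.hom, congrArg (fun z : ULift (P.A.obj ⟶ M) => z.down.hom) hk⟩
  · intro h g
    obtain ⟨k, hk⟩ := h g.down.hom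
    exact ⟨ULift.up (ModuleCat.ofHom k), congrArg ULift.up (ModuleCat.hom_ext hk)⟩

/-- Vanishing of the extension of `Q` does not depend on the presentation. -/
theorem extends_of_extends (P' : FunctorPresentation Q) {M : ModuleCat.{u} R}
    (h : Extends P'.f.hom.hom M) : Extends P.f.hom.hom M := by
  have := IsFPFunctor.additive ⟨P⟩
  intro g
  -- Compare the two presentations on the generators, as for projective resolutions.
  obtain ⟨a, ha⟩ := P'.exists_map_gen P.gen
  obtain ⟨b, hb⟩ := P.exists_map_gen P'.gen
  have h₁ : Q.map (𝟙 P.A - b ≫ a) P.gen = 0 := by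
    rw [Q.map_sub, Q.map_id, Q.map_comp]
    change P.gen - Q.map a (Q.map b P.gen) = 0
    rw [hb, ha, sub_self]
  obtain ⟨s, hs⟩ := (P.map_gen_eq_zero_iff _).1 h₁
  have h₂ : Q.map (b ≫ P'.f) P.gen = 0 := by
    rw [Q.map_comp]
    change Q.map P'.f (Q.map b P.gen) = 0
    rw [hb, P'.map_f_gen]
  obtain ⟨t, ht⟩ := (P.map_gen_eq_zero_iff _).1 h₂
  obtain ⟨k, hk⟩ := h (g ∘ₗ a.hom.hom)
  refine ⟨k ∘ₗ t.hom.hom + g ∘ₗ s.hom.hom, LinearMap.ext fun x => ?_⟩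
  have hs' : s.hom.hom (P.f.hom.hom x) = x - a.hom.hom (b.hom.hom x) :=
    DFunLike.congr_fun (congrArg (fun z : P.A ⟶ P.A => z.hom.hom) hs) x
  have ht' : t.hom.hom (P.f.hom.hom x) = P'.f.hom.hom (b.hom.hom x) :=
    DFunLike.congr_fun (congrArg (fun z : P.A ⟶ P'.B => z.hom.hom) ht) x
  have hk' : k (P'.f.hom.hom (b.hom.hom x)) = g (a.hom.hom (b.hom.hom x)) :=
    DFunLike.congr_fun hk (b.hom.hom x)
  simp [hs', ht', hk']

theorem extensionVanishes_iff (M : ModuleCat.{u} R) :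
    ExtensionVanishes Q M ↔ Extends P.f.hom.hom M :=
  ⟨fun ⟨P', h⟩ => P.extends_of_extends P' ((P'.isZero_extension_obj_iff M).1 h),
    fun h => ⟨P, (P.isZero_extension_obj_iff M).2 h⟩⟩

end FunctorPresentation

open FunctorPresentation

/-- Every map between finitely presented modules presents a functor. -/
theorem exists_functorPresentation {X Y : Type u} [AddCommGroup X] [Module R X] [AddCommGroup Y]
    [Module R Y] [hX : Module.FinitePresentation R X] [hY : Module.FinitePresentation R Y]
    (f : X →ₗ[R] Y) :
    ∃ Q : FPMod R ⥤ AddCommGrpCat.{u + 1}, IsFPFunctor Q ∧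
      ∀ M : ModuleCat.{u} R, ExtensionVanishes Q M ↔ Extends f M := by
  let A : FPMod R := ⟨ModuleCat.of R X, hX⟩
  let B : FPMod R := ⟨ModuleCat.of R Y, hY⟩
  let f' : A ⟶ B := ObjectProperty.homMk (ModuleCat.ofHom f)
  let P : FunctorPresentation (cokernel ((homFunctor (FPMod R)).map f'.op)) :=
    { f := f'
      π := cokernel.π _
      comp_zero := cokernel.condition _
      exact := ShortComplex.exact_cokernel _
      epi := inferInstance }
  exact ⟨_, ⟨P⟩, fun M => P.extensionVanishes_iff M⟩

/-! ### Auslander-Gruson-Jensen duality -/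

/-- The contravariant functor `Q ↦ (N ↦ Hom(Q, T(N, -)))` given by a bifunctor `T`. -/
noncomputable abbrev homInto (T : FPMod S ⥤ FPMod R ⥤ AddCommGrpCat.{u + 1}) :
    (FPMod R ⥤ AddCommGrpCat.{u + 1})ᵒᵖ ⥤ (FPMod S ⥤ AddCommGrpCat.{u + 1}) :=
  preadditiveCoyoneda ⋙ (Functor.whiskeringLeft _ _ _).obj T

/-- Since `Hom(Q, T(N, -))` is the kernel of `T(N, A) → T(N, B)`, for a presentation of `Q` by
`A → B`, it has a presentation as soon as the functor `N ↦ ker (T(N, A) → T(N, B))` has one. -/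
theorem exists_presentation_homInto (T : FPMod S ⥤ FPMod R ⥤ AddCommGrpCat.{u + 1}) [T.Additive]
    [∀ N, (T.obj N).Additive] {Q : FPMod R ⥤ AddCommGrpCat.{u + 1}} (P : FunctorPresentation Q)
    {A B : FPMod S} (f : A ⟶ B) (t : (T.obj A).obj P.A) (ht : (T.obj A).map P.f t = 0)
    (hs : ∀ (N : FPMod S) (s : (T.obj N).obj P.A), (T.obj N).map P.f s = 0 →
      ∃ v : A ⟶ N, (T.map v).app P.A t = s)
    (hf : ∀ (N : FPMod S) (v : A ⟶ N), (T.map v).app P.A t = 0 ↔ ∃ w : B ⟶ N, f ≫ w = v) :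
    ∃ P' : FunctorPresentation ((homInto T).obj (op Q)), ∀ M : ModuleCat.{u} S,
      Extends P'.f.hom.hom M ↔ Extends f.hom.hom M := by
  have hadd {X Y : FPMod S} (g h : X ⟶ Y) (θ : Q ⟶ T.obj X) :
      θ ≫ T.map (g + h) = θ ≫ T.map g + θ ≫ T.map h := by
    rw [T.map_add, Preadditive.comp_add]
  have : ((homInto T).obj (op Q)).Additive :=
    ⟨fun {X Y g h} => AddCommGrpCat.hom_ext (AddMonoidHom.ext fun θ => hadd g h θ)⟩
  obtain ⟨θ, hθ⟩ := P.exists_desc t ht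
  refine exists_of_generator f (Q := (homInto T).obj (op Q)) θ (fun N φ => ?_) fun N v => ?_
  · have hφ : (T.obj N).map P.f (φ.app P.A P.gen) = 0 := by
      have := ConcreteCategory.congr_hom (φ.naturality P.f) P.gen
      refine this.symm.trans ?_
      change φ.app P.B (Q.map P.f P.gen) = 0
      rw [P.map_f_gen, map_zero]
    obtain ⟨v, hv⟩ := hs N _ hφ
    refine ⟨v, P.hom_ext_gen (θ := θ ≫ T.map v) ?_⟩
    change (T.map v).app P.A (θ.app P.A P.gen) = _
    rw [hθ, hv]
  · rw [← hf, ← hθ]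
    constructor
    · intro h
      exact ConcreteCategory.congr_hom (NatTrans.congr_app h P.A) P.gen
    · intro h
      exact P.hom_ext_gen (θ := θ ≫ T.map v) (θ' := 0) h

end Functors

section Comparison

variable {R S : Type u} [Ring R] [Ring S] (σ : AntiEquiv R S)

open FunctorPresentation Tens

/-- Interchanging the two factors of a tensor product. -/
def Tens.swap (N M : Type u) [AddCommGroup N] [Module S N] [AddCommGroup M] [Module R M] :
    Tens σ N M →+ Tens σ.symm M N :=
  Tens.lift σ (tmulHom σ.symm).flip fun n r m => by
    change tmul σ.symm m (σ.toFun r • n) = tmul σ.symm (r • m) n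
    rw [← smul_tmul]
    change tmul σ.symm (σ.inv (σ.toFun r) • m) n = _
    rw [σ.left_inv]

/-- The tensor product is symmetric. -/
def Tens.swapEquiv (N M : Type u) [AddCommGroup N] [Module S N] [AddCommGroup M] [Module R M] :
    Tens σ N M ≃+ Tens σ.symm M N :=
  AddMonoidHom.toAddEquiv (Tens.swap σ N M) (Tens.swap σ.symm M N)
    (Tens.hom_ext (φ := (Tens.swap σ.symm M N).comp (Tens.swap σ N M))
      (ψ := AddMonoidHom.id (Tens σ N M)) fun _ _ => rfl)
    (Tens.hom_ext (φ := (Tens.swap σ N M).comp (Tens.swap σ.symm M N))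
      (ψ := AddMonoidHom.id (Tens σ.symm M N)) fun _ _ => rfl)

/-- If the bifunctor `T` is the tensor product, then `Hom(Q, T(N, -))`, as a functor of `N`, has a
presentation `A' → B'` such that a module `N` is injective with respect to `A' → B'` iff its dual is
injective with respect to the presentation of `Q`: both say that `N ⊗ f` is injective. -/
theorem exists_presentation_of_tensor (T : FPMod S ⥤ FPMod R ⥤ AddCommGrpCat.{u + 1})
    (c : ∀ (N : FPMod S) (X : FPMod R), (T.obj N).obj X ≃+ Tens σ N.obj X.obj)
    (hc₁ : ∀ (N : FPMod S) {X Y : FPMod R} (f : X ⟶ Y) (z : (T.obj N).obj X),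
      c N Y ((T.obj N).map f z) = Tens.map σ LinearMap.id f.hom.hom (c N X z))
    (hc₂ : ∀ {N N' : FPMod S} (v : N ⟶ N') (X : FPMod R) (z : (T.obj N).obj X),
      c N' X ((T.map v).app X z) = Tens.map σ v.hom.hom LinearMap.id (c N X z))
    {Q : FPMod R ⥤ AddCommGrpCat.{u + 1}} (P : FunctorPresentation Q) :
    ∃ P' : FunctorPresentation ((homInto T).obj (op Q)), ∀ N : ModuleCat.{u} S,
      Extends P'.f.hom.hom N ↔ Extends P.f.hom.hom (Dual σ.symm N) := by
  have add₁ : T.Additive := ⟨fun {N N' v w} => by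
    ext X z
    refine (c N' X).injective ?_
    refine (hc₂ _ X z).trans ((map_add_left σ _ _ _ _).trans ?_)
    exact (congrArg₂ (· + ·) (hc₂ v X z) (hc₂ w X z)).symm.trans ((c N' X).map_add _ _).symm⟩
  have add₂ (N : FPMod S) : (T.obj N).Additive := ⟨fun {X Y f g} => by
    refine AddCommGrpCat.hom_ext (AddMonoidHom.ext fun z => ?_)
    refine (c N Y).injective ?_
    refine (hc₁ N _ z).trans ((map_add_right σ _ _ _ _).trans ?_)
    exact (congrArg₂ (· + ·) (hc₁ N f z) (hc₁ N g z)).symm.trans ((c N Y).map_add _ _).symm⟩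
  have hA := P.A.property
  have hB := P.B.property
  obtain ⟨A', _, _, hA', B', _, _, hB', f', t, ht, hs, hf⟩ :=
    exists_presentation_ker σ P.f.hom.hom
  let A₀ : FPMod S := ⟨ModuleCat.of S A', hA'⟩
  let B₀ : FPMod S := ⟨ModuleCat.of S B', hB'⟩
  obtain ⟨P', hP'⟩ := exists_presentation_homInto T P (A := A₀) (B := B₀)
    (ObjectProperty.homMk (ModuleCat.ofHom f')) ((c A₀ P.A).symm t)
    ((c A₀ P.B).injective (by rw [hc₁, AddEquiv.apply_symm_apply, map_zero]; exact ht))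
    (fun N s h => by
      obtain ⟨v, hv⟩ := hs N.obj (c N P.A s) (by rw [← hc₁, h, map_zero])
      refine ⟨ObjectProperty.homMk (ModuleCat.ofHom v), (c N P.A).injective ?_⟩
      rw [hc₂, AddEquiv.apply_symm_apply]
      exact hv)
    (fun N v => by
      rw [← (c N P.A).map_eq_zero_iff, hc₂, AddEquiv.apply_symm_apply]
      refine (hf N.obj v.hom.hom).trans ⟨?_, ?_⟩
      · rintro ⟨w, hw⟩
        exact ⟨ObjectProperty.homMk (ModuleCat.ofHom w),
          ObjectProperty.hom_ext _ (ModuleCat.hom_ext hw)⟩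
      · rintro ⟨w, rfl⟩
        exact ⟨w.hom.hom, rfl⟩)
  refine ⟨P', fun N => (hP' N).trans (Iff.trans ?_ (map_injective_iff_extends_dual σ _))⟩
  constructor
  · intro h s hs₀
    obtain ⟨u, rfl⟩ := hs N s hs₀
    exact (hf N u).2 (h u)
  · intro h u
    refine (hf N u).1 (h _ ?_)
    have : Tens.map σ LinearMap.id P.f.hom.hom (Tens.map σ u LinearMap.id t) =
        Tens.map σ u LinearMap.id (Tens.map σ LinearMap.id P.f.hom.hom t) := by
      rw [map_map, map_map]; rfl
    rw [this, ht, map_zero]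

end Comparison

section AGJPresentation

variable (R : Type u) [Ring R]

theorem balancedMap_apply {M M' N N' : Type u} [AddCommGroup M] [Module Rᵐᵒᵖ M] [AddCommGroup M']
    [Module Rᵐᵒᵖ M'] [AddCommGroup N] [Module R N] [AddCommGroup N'] [Module R N']
    (f : M →ₗ[Rᵐᵒᵖ] M') (g : N →ₗ[R] N') (z : BalancedTensor R M N) :
    balancedMap R f g z = Tens.map (AntiEquiv.op R) (N := M) (M := N) f g z :=
  DFunLike.congr_fun (balanced_hom_ext R (φ := balancedMap R f g)
    (ψ := Tens.map (AntiEquiv.op R) (N := M) (M := N) f g) fun _ _ => rfl) z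

/-- The tensor product over `R` with its factors interchanged. -/
def balancedSwap (M N : Type u) [AddCommGroup M] [Module Rᵐᵒᵖ M] [AddCommGroup N] [Module R N] :
    BalancedTensor R M N ≃+ Tens (AntiEquiv.op R).symm N M :=
  Tens.swapEquiv (AntiEquiv.op R) M N

theorem balancedSwap_map {M M' N N' : Type u} [AddCommGroup M] [Module Rᵐᵒᵖ M] [AddCommGroup M']
    [Module Rᵐᵒᵖ M'] [AddCommGroup N] [Module R N] [AddCommGroup N'] [Module R N']
    (f : M →ₗ[Rᵐᵒᵖ] M') (g : N →ₗ[R] N') (z : BalancedTensor R M N) :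
    balancedSwap R M' N' (balancedMap R f g z) =
      Tens.map (AntiEquiv.op R).symm g f (balancedSwap R M N z) :=
  DFunLike.congr_fun (balanced_hom_ext R
    (φ := (balancedSwap R M' N').toAddMonoidHom.comp (balancedMap R f g))
    (ψ := (Tens.map (AntiEquiv.op R).symm g f).comp (balancedSwap R M N).toAddMonoidHom)
    fun _ _ => rfl) z

/-- The extension of `δ Q` vanishes at `N` iff the extension of `Q` vanishes at the dual of `N`. -/
theorem exists_presentation_agj {Q : FPMod R ⥤ AddCommGrpCat.{u + 1}}
    (P : FunctorPresentation Q) :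
    ∃ P' : FunctorPresentation ((agj R).obj (op Q)), ∀ N : ModuleCat.{u} Rᵐᵒᵖ,
      Extends P'.f.hom.hom N ↔ Extends P.f.hom.hom (charDualOp R N) :=
  exists_presentation_of_tensor (AntiEquiv.op R) (tensorFP R) (fun _ _ => AddEquiv.ulift)
    (fun _ {_ _} f z => balancedMap_apply R LinearMap.id f.hom.hom z.down)
    (fun v _ z => balancedMap_apply R v.hom.hom LinearMap.id z.down) P

/-- The extension of `δ F` vanishes at `M` iff the extension of `F` vanishes at the dual of `M`. -/
theorem exists_presentation_agjOp {F : FPMod Rᵐᵒᵖ ⥤ AddCommGrpCat.{u + 1}}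
    (P : FunctorPresentation F) :
    ∃ P' : FunctorPresentation ((agjOp R).obj (op F)), ∀ M : ModuleCat.{u} R,
      Extends P'.f.hom.hom M ↔ Extends P.f.hom.hom (charDual R M) :=
  exists_presentation_of_tensor (AntiEquiv.op R).symm (tensorFP R).flip
    (fun M N => AddEquiv.ulift.trans (balancedSwap R N.obj M.obj))
    (fun _ {_ _} f z => balancedSwap_map R f.hom.hom LinearMap.id z.down)
    (fun v _ z => balancedSwap_map R LinearMap.id v.hom.hom z.down) P

end AGJPresentation

/-! ### Definable classes -/

section Definable

variable {R : Type u} [Ring R]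

theorem IsDefinable.functorKer_annihilator {D : ObjectProperty (ModuleCat.{u} R)}
    (hD : IsDefinable D) : D = functorKer (annihilator D) := by
  obtain ⟨𝒮, h𝒮, rfl⟩ := hD
  refine le_antisymm (fun M hM Q hQ => hQ.2 M hM) fun M hM Q hQ => hM Q ⟨h𝒮 Q hQ, ?_⟩
  exact fun M' hM' => hM' Q hQ

section Extends

variable {X Y : Type u} [AddCommGroup X] [Module R X] [AddCommGroup Y] [Module R Y]
  (f : X →ₗ[R] Y)

theorem Extends.of_retract {M N : ModuleCat.{u} R} (r : Retract M N) (hN : Extends f N) :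
    Extends f M := by
  intro h
  obtain ⟨k, hk⟩ := hN (r.i.hom ∘ₗ h)
  refine ⟨r.r.hom ∘ₗ k, ?_⟩
  rw [LinearMap.comp_assoc, hk, ← LinearMap.comp_assoc, ← ModuleCat.hom_comp, r.retract]
  rfl

theorem Extends.of_isLimit {ι : Type*} {F : Discrete ι ⥤ ModuleCat.{u} R} {c : Cone F}
    (hc : IsLimit c) (hF : ∀ i, Extends f (F.obj i)) : Extends f c.pt := by
  intro h
  choose k hk using fun i => hF i ((c.π.app i).hom ∘ₗ h)
  let s : Cone F := ⟨ModuleCat.of R Y, Discrete.natTrans fun i => ModuleCat.ofHom (k i)⟩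
  refine ⟨(hc.lift s).hom, ?_⟩
  refine congrArg ModuleCat.Hom.hom (hc.hom_ext (W := ModuleCat.of R X)
    (f := ModuleCat.ofHom f ≫ hc.lift s) (f' := ModuleCat.ofHom h) fun i => ?_)
  rw [Category.assoc, hc.fac s i]
  exact ModuleCat.hom_ext (hk i)

theorem Extends.of_isColimit {ι : Type*} [Finite ι] {F : Discrete ι ⥤ ModuleCat.{u} R}
    {c : Cocone F} (hc : IsColimit c) (hF : ∀ i, Extends f (F.obj i)) : Extends f c.pt := by
  classical
  have := Fintype.ofFinite ι
  -- A finite coproduct is a biproduct: construct its projections.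
  let p (i : ι) : c.pt ⟶ F.obj ⟨i⟩ := hc.desc ⟨_, Discrete.natTrans fun j =>
    if h : j = ⟨i⟩ then eqToHom (by rw [h]; rfl) else 0⟩
  have hp (i j : ι) : c.ι.app ⟨j⟩ ≫ p i = if h : j = i then eqToHom (by rw [h]) else 0 := by
    refine (hc.fac _ _).trans ?_
    simp [Discrete.ext_iff]
  have hid : ∑ i, p i ≫ c.ι.app ⟨i⟩ = 𝟙 c.pt := by
    refine hc.hom_ext fun ⟨j⟩ => ?_
    rw [Preadditive.comp_sum, Finset.sum_eq_single j]
    · rw [← Category.assoc, hp, dif_pos rfl]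
      simp
    · intro i _ hij
      rw [← Category.assoc, hp, dif_neg hij.symm, zero_comp]
    · simp
  intro h
  choose k hk using fun i : ι => hF ⟨i⟩ ((p i).hom ∘ₗ h)
  refine ⟨∑ i, (c.ι.app ⟨i⟩).hom ∘ₗ k i, LinearMap.ext fun x => ?_⟩
  have e : (∑ i, p i ≫ c.ι.app ⟨i⟩).hom (h x) = h x := by rw [hid]; rfl
  rw [ModuleCat.hom_sum] at e
  rw [← e]
  simp only [LinearMap.comp_apply, LinearMap.sum_apply]
  exact Finset.sum_congr rfl fun i _ => congrArg (c.ι.app ⟨i⟩).hom (DFunLike.congr_fun (hk i) x)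

end Extends

namespace IsDefinable

variable {D : ObjectProperty (ModuleCat.{u} R)}

/-- Definable classes are determined by the maps with respect to which all of their members are
injective. -/
theorem mem_of_extends (hD : IsDefinable D) {M : ModuleCat.{u} R}
    (h : ∀ (X Y : FPMod R) (f : X ⟶ Y), (∀ N, D N → Extends f.hom.hom N) → Extends f.hom.hom M) :
    D M := by
  obtain ⟨𝒮, h𝒮, rfl⟩ := hD
  intro Q hQ
  obtain ⟨P⟩ := h𝒮 Q hQ
  exact (P.extensionVanishes_iff M).2 (h _ _ P.f fun N hN => (P.extensionVanishes_iff N).1 (hN Q hQ))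

theorem isProductClosed (hD : IsDefinable D) : IsProductClosed D := fun _ =>
  ⟨fun _ ⟨h⟩ => hD.mem_of_extends fun _ _ f hf =>
    Extends.of_isLimit f.hom.hom h.isLimit fun i => hf _ (h.prop_diag_obj i)⟩

theorem isClosedUnderFiniteCoproducts (hD : IsDefinable D) : D.IsClosedUnderFiniteCoproducts :=
  ⟨fun _ _ => ⟨fun _ ⟨h⟩ => hD.mem_of_extends fun _ _ f hf =>
    Extends.of_isColimit f.hom.hom h.isColimit fun i => hf _ (h.prop_diag_obj i)⟩⟩

theorem isStableUnderRetracts (hD : IsDefinable D) : D.IsStableUnderRetracts :=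
  ⟨fun r hN => hD.mem_of_extends fun _ _ f hf => Extends.of_retract f.hom.hom r (hf _ hN)⟩

theorem bidual_iff (hD : IsDefinable D) (M : ModuleCat.{u} R) :
    D (charDualOp R (charDual R M)) ↔ D M := by
  have key (X Y : FPMod R) (f : X ⟶ Y) :
      Extends f.hom.hom M ↔ Extends f.hom.hom (charDualOp R (charDual R M)) :=
    have := X.property
    have := Y.property
    extends_iff_extends_bidual (AntiEquiv.op R) f.hom.hom
  exact ⟨fun h => hD.mem_of_extends fun X Y f hf => (key X Y f).2 (hf _ h),
    fun h => hD.mem_of_extends fun X Y f hf => (key X Y f).1 (hf _ h)⟩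

theorem dualDefinable_iff (hD : IsDefinable D) (N : ModuleCat.{u} Rᵐᵒᵖ) :
    dualDefinable R D N ↔ D (charDualOp R N) := by
  have key (Q : FPMod R ⥤ AddCommGrpCat.{u + 1}) (hQ : annihilator D Q) :
      ExtensionVanishes ((agj R).obj (op Q)) N ↔ ExtensionVanishes Q (charDualOp R N) := by
    obtain ⟨P⟩ := hQ.1
    obtain ⟨P', hP'⟩ := exists_presentation_agj R P
    rw [P.extensionVanishes_iff, P'.extensionVanishes_iff, hP']
  rw [congrFun hD.functorKer_annihilator (charDualOp R N)]
  constructor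
  · exact fun h Q hQ => (key Q hQ).1 (h _ ⟨Q, hQ, rfl⟩)
  · rintro h _ ⟨Q, hQ, rfl⟩
    exact (key Q hQ).2 (h Q hQ)

theorem dualDefinableOp_iff {D : ObjectProperty (ModuleCat.{u} Rᵐᵒᵖ)} (hD : IsDefinable D)
    (M : ModuleCat.{u} R) : dualDefinableOp R D M ↔ D (charDual R M) := by
  have key (F : FPMod Rᵐᵒᵖ ⥤ AddCommGrpCat.{u + 1}) (hF : annihilator D F) :
      ExtensionVanishes ((agjOp R).obj (op F)) M ↔ ExtensionVanishes F (charDual R M) := by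
    obtain ⟨P⟩ := hF.1
    obtain ⟨P', hP'⟩ := exists_presentation_agjOp R P
    rw [P.extensionVanishes_iff, P'.extensionVanishes_iff, hP']
  rw [congrFun hD.functorKer_annihilator (charDual R M)]
  constructor
  · exact fun h Q hQ => (key Q hQ).1 (h _ ⟨Q, hQ, rfl⟩)
  · rintro h _ ⟨Q, hQ, rfl⟩
    exact (key Q hQ).2 (h Q hQ)

end IsDefinable

theorem isDefinable_dualDefinable (D : ObjectProperty (ModuleCat.{u} R)) :
    IsDefinable (dualDefinable R D) := by
  refine ⟨_, ?_, rfl⟩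
  rintro _ ⟨Q, ⟨⟨P⟩, _⟩, rfl⟩
  obtain ⟨P', _⟩ := exists_presentation_agj R P
  exact ⟨P'⟩

theorem IsDefinable.isSymmetricDualityPair {D : ObjectProperty (ModuleCat.{u} R)}
    (hD : IsDefinable D) : IsSymmetricDualityPair R D (dualDefinable R D) :=
  ⟨⟨fun M => (hD.bidual_iff M).symm.trans (hD.dualDefinable_iff (charDual R M)).symm,
    (isDefinable_dualDefinable D).isClosedUnderFiniteCoproducts,
    (isDefinable_dualDefinable D).isStableUnderRetracts⟩,
   ⟨hD.dualDefinable_iff, hD.isClosedUnderFiniteCoproducts, hD.isStableUnderRetracts⟩⟩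

end Definable

/-! ### Symmetric duality pairs -/

section SymmetricPairs

open DirectSum

variable {R S : Type u} [Ring R] [Ring S] (σ : AntiEquiv R S)

/-- The character dual along the anti-isomorphism `σ`, as a map on objects. -/
def dualObj (M : ModuleCat.{u} R) : ModuleCat.{u} S := ModuleCat.of S (Dual σ M)

/-- Symmetric duality pairs with respect to an anti-isomorphism `σ`. -/
def IsSymmPair (A : ObjectProperty (ModuleCat.{u} R)) (B : ObjectProperty (ModuleCat.{u} S)) :
    Prop :=
  IsDualityPair (dualObj σ) A B ∧ IsDualityPair (dualObj σ.symm) B A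

variable {σ} {A : ObjectProperty (ModuleCat.{u} R)} {B : ObjectProperty (ModuleCat.{u} S)}

theorem IsSymmPair.symm (h : IsSymmPair σ A B) : IsSymmPair σ.symm B A := ⟨h.2, h.1⟩

theorem IsSymmPair.of_pure (h : IsSymmPair σ A B) {K L : ModuleCat.{u} R} {j : K →ₗ[R] L}
    (hj : IsPureMap j) (hL : A L) : A K := by
  have := h.1.summands
  obtain ⟨s, hs⟩ := hj.exists_section σ
  let r : Retract (dualObj σ K) (dualObj σ L) :=
    ⟨ModuleCat.ofHom s, ModuleCat.ofHom (Dual.map σ j), ModuleCat.hom_ext hs⟩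
  exact (h.1.mem_iff K).2 (B.prop_of_retract r ((h.1.mem_iff L).1 hL))

theorem IsProductClosed.pi (hA : IsProductClosed A) [A.IsClosedUnderIsomorphisms] {ι : Type u}
    (M : ι → ModuleCat.{u} R) (hM : ∀ i, A (M i)) : A (ModuleCat.of R (∀ i, M i)) := by
  have := hA ι
  exact A.prop_of_isLimit (ModuleCat.productConeIsLimit M) fun i => hM i.as

theorem IsCoproductClosed.directSum (hA : IsCoproductClosed A) [A.IsClosedUnderIsomorphisms]
    {ι : Type u} (M : ι → ModuleCat.{u} R) (hM : ∀ i, A (M i)) :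
    A (ModuleCat.of R (⨁ i, M i)) := by
  classical
  have := hA ι
  exact A.prop_of_isColimit (ModuleCat.coproductCoconeIsColimit M) fun i => hM i.as

/-- A direct sum is pure in the product, because a map from a finitely generated module to the
direct sum has its image in a finite partial sum, onto which the product projects. -/
theorem isPureMap_directSum {ι : Type u} (M : ι → ModuleCat.{u} R) :
    IsPureMap (DirectSum.coeFnLinearMap R : (⨁ i, M i) →ₗ[R] ∀ i, M i) := by
  classical
  intro X Y _ _ _ _ _ _ f h k hk
  let p (F : Finset ι) : (∀ i, M i) →ₗ[R] ⨁ i, M i :=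
    ∑ i ∈ F, DirectSum.lof R ι (fun i => M i) i ∘ₗ LinearMap.proj i
  have hp (F : Finset ι) (y : ⨁ i, M i) (hy : DFinsupp.support y ⊆ F) :
      p F (DirectSum.coeFnLinearMap R y) = y := by
    conv_rhs => rw [← DirectSum.sum_support_of y]
    simp only [p, LinearMap.sum_apply, LinearMap.comp_apply, LinearMap.proj_apply,
      DirectSum.coeFnLinearMap_apply, DirectSum.lof_eq_of]
    refine (Finset.sum_subset hy fun i _ hi => ?_).symm
    rw [DFinsupp.notMem_support_iff.1 hi, map_zero]
  obtain ⟨n, q, hq⟩ := Module.Finite.exists_fin' R X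
  let F : Finset ι := Finset.univ.biUnion fun a : Fin n =>
    DFinsupp.support (h (q (Pi.single a 1)))
  have key : (p F ∘ₗ DirectSum.coeFnLinearMap R) ∘ₗ (h ∘ₗ q) = h ∘ₗ q := by
    refine LinearMap.pi_ext' fun a => LinearMap.ext_ring ?_
    exact hp F _ (Finset.subset_biUnion_of_mem
      (fun a : Fin n => DFinsupp.support (h (q (Pi.single a 1)))) (Finset.mem_univ a))
  refine ⟨p F ∘ₗ k, ?_⟩
  rw [LinearMap.comp_assoc, hk]
  refine LinearMap.ext fun x => ?_
  obtain ⟨r, rfl⟩ := hq x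
  exact DFunLike.congr_fun key r

/-- The coproduct is pure in the product, which is in `A`. -/
theorem IsSymmPair.isCoproductClosed (h : IsSymmPair σ A B) (hA : IsProductClosed A) :
    IsCoproductClosed A := by
  classical
  have := h.2.summands
  intro ι
  refine ⟨fun X ⟨c⟩ => ?_⟩
  let M (i : ι) : ModuleCat.{u} R := c.diag.obj ⟨i⟩
  have hM : A (ModuleCat.of R (⨁ i, M i)) :=
    h.of_pure (K := ModuleCat.of R (⨁ i, M i)) (L := ModuleCat.of R (∀ i, M i))
      (isPureMap_directSum M) (hA.pi M fun i => c.prop_diag_obj ⟨i⟩)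
  exact A.prop_of_iso (IsColimit.coconePointsIsoOfNatIso (ModuleCat.coproductCoconeIsColimit M)
    c.isColimit Discrete.natIsoFunctor.symm) hM

/-- If the modules `Nᵢ` are in `B`, then the dual of the coproduct of the duals of the `Nᵢ` is in `B`
as well, and the product of the `Nᵢ` is pure in it, since each `Nᵢ` is pure in its double dual. -/
theorem IsSymmPair.isProductClosed (h : IsSymmPair σ A B) (hA : IsCoproductClosed A) :
    IsProductClosed B := by
  classical
  have := h.2.summands
  intro ι
  refine ⟨fun X ⟨c⟩ => ?_⟩
  let N (i : ι) : ModuleCat.{u} S := c.diag.obj ⟨i⟩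
  let pr (i : ι) : X →ₗ[S] N i := (c.π.app ⟨i⟩).hom
  let E := ModuleCat.of R (⨁ i, dualObj σ.symm (N i))
  let g : E →ₗ[R] Dual σ.symm X :=
    DirectSum.toModule R ι _ fun i => Dual.map σ.symm (pr i)
  let j : X →ₗ[S] Dual σ E := Dual.map σ g ∘ₗ Dual.eval σ.symm X
  have hE : B (dualObj σ E) := (h.1.mem_iff E).1
    (hA.directSum _ fun i => (h.2.mem_iff _).1 (c.prop_diag_obj ⟨i⟩))
  refine h.symm.of_pure (K := X) (L := dualObj σ E) (j := j) ?_ hE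
  intro U V _ _ _ _ _ _ f a k hk
  let l (i : ι) : Dual σ E →ₗ[S] Dual σ (Dual σ.symm (N i)) :=
    Dual.map σ (DirectSum.lof R ι (fun i => dualObj σ.symm (N i)) i)
  have hl (i : ι) : l i ∘ₗ j = Dual.eval σ.symm (N i) ∘ₗ pr i :=
    LinearMap.ext fun x => Dual.ext σ fun e =>
      congrArg (fun z : Dual σ.symm X => z x)
        (DirectSum.toModule_lof R (φ := fun i => Dual.map σ.symm (pr i)) i e)
  have ext (i : ι) : ∃ k' : V →ₗ[S] N i, k' ∘ₗ f = pr i ∘ₗ a := by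
    refine exists_extension_of_eval σ.symm f (pr i ∘ₗ a) (l i ∘ₗ k) (LinearMap.ext fun x => ?_)
    exact (congrArg (l i) (DFunLike.congr_fun hk x)).trans (DFunLike.congr_fun (hl i) (a x))
  choose k' hk' using ext
  let s : Cone c.diag := ⟨ModuleCat.of S V, Discrete.natTrans fun i => ModuleCat.ofHom (k' i.as)⟩
  refine ⟨(c.isLimit.lift s).hom, ?_⟩
  refine congrArg ModuleCat.Hom.hom (c.isLimit.hom_ext (W := ModuleCat.of S U)
    (f := ModuleCat.ofHom f ≫ c.isLimit.lift s) (f' := ModuleCat.ofHom a) fun i => ?_)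
  rw [Category.assoc, c.isLimit.fac s i]
  exact ModuleCat.hom_ext (hk' i.as)

/-- The standard finitely presented modules, which form a set. -/
abbrev StdFP (R : Type u) [Ring R] (n : ℕ) (K : Finset (Fin n → R)) : Type u :=
  (Fin n → R) ⧸ Submodule.span R (K : Set (Fin n → R))

theorem exists_equiv_stdFP (X : Type u) [AddCommGroup X] [Module R X]
    [Module.FinitePresentation R X] :
    ∃ (n : ℕ) (K : Finset (Fin n → R)), Nonempty (X ≃ₗ[R] StdFP R n K) := by
  obtain ⟨n, _, e, K, rfl⟩ := Module.FinitePresentation.exists_fin R X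
  exact ⟨n, K, ⟨e⟩⟩

instance (n : ℕ) (K : Finset (Fin n → R)) : Module.FinitePresentation R (StdFP R n K) :=
  finitePresentation_quotient_span _ K.finite_toSet

/-- A substitute for preenvelopes: if `A` is closed under products, then every finitely presented
module `X` has a map to a module in `A` that factors only through those maps `X → Y` to finitely
presented modules with respect to which all modules in `A` are injective. -/
theorem exists_almost_preenvelope (hA : IsProductClosed A) [A.IsClosedUnderIsomorphisms]
    (X : Type u) [AddCommGroup X] [Module R X] :
    ∃ (D : ModuleCat.{u} R) (g : X →ₗ[R] D), A D ∧
      ∀ (Y : Type u) [AddCommGroup Y] [Module R Y] [Module.FinitePresentation R Y]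
        (f : X →ₗ[R] Y) (k : Y →ₗ[R] D), k ∘ₗ f = g → ∀ M : ModuleCat.{u} R, A M → Extends f M := by
  -- Take the product of one counterexample for each map with respect to which not all modules in
  -- `A` are injective.
  let I := {i : Σ (n : ℕ) (K : Finset (Fin n → R)), X →ₗ[R] StdFP R n K //
    ∃ M : ModuleCat.{u} R, A M ∧ ¬ Extends i.2.2 M}
  choose D hD hne using fun i : I => i.2
  simp only [Extends, not_forall] at hne
  choose g hg using hne
  refine ⟨ModuleCat.of R (∀ i, D i), LinearMap.pi g, hA.pi D hD, ?_⟩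
  intro Y _ _ _ f k hk M hM
  by_contra hf
  obtain ⟨n, K, ⟨e⟩⟩ := exists_equiv_stdFP (R := R) Y
  have hef : ¬ Extends (e.toLinearMap ∘ₗ f) M := by
    intro he
    refine hf fun a => ?_
    obtain ⟨b, hb⟩ := he a
    exact ⟨b ∘ₗ e.toLinearMap, hb⟩
  let i : I := ⟨⟨n, K, e.toLinearMap ∘ₗ f⟩, M, hM, hef⟩
  refine hg i ⟨LinearMap.proj i ∘ₗ k ∘ₗ e.symm.toLinearMap, LinearMap.ext fun x => ?_⟩
  have : k (f x) i = g i x := congrFun (DFunLike.congr_fun hk x) i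
  simpa [i] using this

/-- If all functors that annihilate `A` vanish at `M`, then the double dual of `M` is a pure quotient of
a coproduct of modules in `A`; by duality it follows that `M` is in `A`. -/
theorem IsSymmPair.isDefinable (h : IsSymmPair σ A B) (hA : IsProductClosed A) :
    IsDefinable A := by
  classical
  have hAc := h.isCoproductClosed hA
  have := h.1.summands
  have := h.2.summands
  refine ⟨annihilator A, fun Q hQ => hQ.1, le_antisymm (fun M hM Q hQ => hQ.2 M hM) ?_⟩
  intro M hM
  have ext (X Y : Type u) [AddCommGroup X] [Module R X] [AddCommGroup Y] [Module R Y]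
      [Module.FinitePresentation R X] [Module.FinitePresentation R Y] (f : X →ₗ[R] Y)
      (hf : ∀ L : ModuleCat.{u} R, A L → Extends f L) : Extends f M := by
    obtain ⟨Q, hQ, hQf⟩ := exists_functorPresentation f
    exact (hQf M).1 (hM Q ⟨hQ, fun L hL => (hQf L).2 (hf L hL)⟩)
  -- It is enough to show that the double dual `Z` of `M` is in `A`.
  let N := dualObj σ M
  let Z := dualObj σ.symm N
  suffices A Z from (h.1.mem_iff M).2 ((h.2.mem_iff N).2 this)
  -- Every map from a finitely presented module to `Z` factors through a module in `A`.
  have factor (X : Type u) [AddCommGroup X] [Module R X] [Module.FinitePresentation R X]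
      (a : X →ₗ[R] Z) :
      ∃ (D : ModuleCat.{u} R) (g : X →ₗ[R] D) (e : D →ₗ[R] Z), A D ∧ e ∘ₗ g = a := by
    obtain ⟨D, g, hD, hg⟩ := exists_almost_preenvelope hA X
    have inj : ∀ t : Tens σ N X, Tens.map σ LinearMap.id g t = 0 → t = 0 := by
      intro t ht
      obtain ⟨Y, _, _, _, f, k, hk, hft⟩ := Tens.exists_factorization σ g t ht
      exact (extends_iff_map_dual_injective σ f).1 (ext X Y f (hg Y f k hk)) t hft
    obtain ⟨e, he⟩ := (map_injective_iff_extends_dual σ g).1 inj a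
    exact ⟨D, g, e, hD, he⟩
  -- Hence `Z` is a pure quotient of a coproduct of modules in `A`.
  let J := Σ (n : ℕ) (K : Finset (Fin n → R)), StdFP R n K →ₗ[R] Z
  choose D g e hD he using fun i : J => factor _ i.2.2
  let E := ModuleCat.of R (⨁ i, D i)
  obtain ⟨r, hr⟩ := exists_retraction_dual_map σ (M := E) (M' := Z) (DirectSum.toModule R J Z e) (by
    intro X _ _ _ a
    obtain ⟨n, K, ⟨ε⟩⟩ := exists_equiv_stdFP (R := R) X
    let i : J := ⟨n, K, a ∘ₗ ε.symm.toLinearMap⟩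
    refine ⟨DirectSum.lof R J (fun i => D i) i ∘ₗ g i ∘ₗ ε.toLinearMap, LinearMap.ext fun x => ?_⟩
    refine (DirectSum.toModule_lof R i _).trans ?_
    refine (DFunLike.congr_fun (he i) (ε x)).trans ?_
    simp [i])
  let ret : Retract (dualObj σ Z) (dualObj σ E) :=
    ⟨ModuleCat.ofHom (Dual.map σ (DirectSum.toModule R J Z e)), ModuleCat.ofHom r,
      ModuleCat.hom_ext hr⟩
  exact (h.1.mem_iff Z).2 (B.prop_of_retract ret ((h.1.mem_iff E).1 (hAc.directSum D hD)))

end SymmetricPairs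

theorem mainTheorem5 (R : Type u) [Ring R] :
    (∀ D : ObjectProperty (ModuleCat.{u} R), IsDefinable D →
      IsSymmetricDualityPair R D (dualDefinable R D) ∧ IsProductClosed D) ∧
    (∀ (A : ObjectProperty (ModuleCat.{u} R)) (B : ObjectProperty (ModuleCat.{u} Rᵐᵒᵖ)),
      IsSymmetricDualityPair R A B →
        List.TFAE [
          IsCoproductClosed A ∨ IsCoproductClosed B,
          IsProductClosed A ∨ IsProductClosed B,
          IsDefinable A ∧ B = dualDefinable R A,
          IsDefinable B ∧ A = dualDefinableOp R B] ∧
        ((IsCoproductClosed A ∨ IsCoproductClosed B ∨ IsProductClosed A ∨ IsProductClosed B) →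
          (IsCoproductClosed A ∧ IsCoproductClosed B ∧ IsProductClosed A ∧ IsProductClosed B) ∧
          IsDefinable A ∧ IsDefinable B)) := by
  refine ⟨fun D hD => ⟨hD.isSymmetricDualityPair, hD.isProductClosed⟩, fun A B hAB => ?_⟩
  have h : IsSymmPair (AntiEquiv.op R) A B := hAB
  have all : (IsCoproductClosed A ∨ IsCoproductClosed B ∨ IsProductClosed A ∨ IsProductClosed B) →
      (IsCoproductClosed A ∧ IsCoproductClosed B ∧ IsProductClosed A ∧ IsProductClosed B) ∧
        IsDefinable A ∧ IsDefinable B := by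
    have cA : IsProductClosed A → IsCoproductClosed A := h.isCoproductClosed
    have cB : IsProductClosed B → IsCoproductClosed B := h.symm.isCoproductClosed
    have pB : IsCoproductClosed A → IsProductClosed B := h.isProductClosed
    have pA : IsCoproductClosed B → IsProductClosed A := h.symm.isProductClosed
    have dA : IsProductClosed A → IsDefinable A := h.isDefinable
    have dB : IsProductClosed B → IsDefinable B := h.symm.isDefinable
    tauto
  refine ⟨?_, all⟩
  tfae_have 1 → 2 := fun H => Or.inl (all (by tauto)).1.2.2.1
  tfae_have 2 → 3 := fun H => by
    have hA := (all (by tauto)).2.1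
    exact ⟨hA, funext fun N => propext ((h.2.mem_iff N).trans (hA.dualDefinable_iff N).symm)⟩
  tfae_have 2 → 4 := fun H => by
    have hB := (all (by tauto)).2.2
    exact ⟨hB, funext fun M => propext ((h.1.mem_iff M).trans (hB.dualDefinableOp_iff M).symm)⟩
  tfae_have 3 → 1 := fun H => Or.inl (h.isCoproductClosed H.1.isProductClosed)
  tfae_have 4 → 1 := fun H => Or.inr (h.symm.isCoproductClosed H.1.isProductClosed)
  tfae_finish
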